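/- Let $(\Omega,\mu)$ be a Lebesgue space, i.e. a probability space isomorphic mod $0$ to a Borel probability measure on the line, and let $T:\Omega\to\Omega$ be an invertible (bijective) measure-preserving transformation which is non-periodic: $\mu(\{\omega : T^i\omega=\omega \text{ for some } i\ge 1\})=0$. A countable measurable partition, given by a measurable labeling function $p$ on $\Omega$, is a generator of $T$ if, off a null set, distinct points have distinct doubly infinite names $(p(T^k\omega))_{k\in\mathbb Z}$. For a measurable $h:\Omega\to\{1,2,3,\dots\}$ consider the property (*) off a null set, if $h(T^{-1}\omega)=n$, then $h(T^{-n}\omega),h(T^{1-n}\omega),\dots,h(T^{-1}\omega)$ determine $h(\omega)$; that is, there is a null set $Z$ such that for all $\omega,\omega'\notin Z$ and all $n$, if $h(T^{-1}\omega)=h(T^{-1}\omega')=n$ and $h(T^{-k}\omega)=h(T^{-k}\omega')$ for $1\le k\le n$, then $h(\omega)=h(\omega')$. Then: (a) There is a generator $h:\Omega\to\{1,2,3,\dots\}$ of $T$ with property (*). (b) (The future says almost nothing about the past.) For every countable generator $P$ of $T$ and every $\varepsilon>0$ there is a generator $h:\Omega\to\{1,2,3,\dots\}$ of $T$ with property (*)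 such that, off a null set, $h(\omega)$ determines $P(\omega)$, and (i) there is a measurable $f:\Omega\to\mathbb N$ with Shannon entropy $H(f)<\varepsilon$ such that, off a null set, the future $(h(T^k\omega))_{k\ge1}$ is determined by $(P(T^k\omega),f(T^k\omega))_{k\ge1}$; (ii) if the Shannon entropy $H(P)$ is finite, then $$H\bigl(P \mid h\circ T,\,h\circ T^2,\,h\circ T^3,\dots\bigr)\ \ge\ h_\mu(T,P)-\varepsilon,$$ where the left side is the conditional Shannon entropy of $P$ given the $\sigma$-algebra generated by the future of $h$, and $h_\mu(T,P)=\lim_n \frac1n H(P,P\circ T,\dots,P\circ T^{n-1})$ is the full entropy of the process $(P\circ T^k)_{k\in\mathbb Z}$. (c) There is a generator $h:\Omega\to\{1,2,3,\dots\}$ of $T$ for which (*) holds both for $T$ and for $T^{-1}$; i.e., in addition to (*), off a null set, if $h(T\omega)=n$, then $h(T\omega),h(T^2\omega),\dots,h(T^n\omega)$ determine $h(\omega)$. -/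

import Mathlib

open MeasureTheory
open scoped ENNReal

namespace Kalikow

/-- `(Ω, μ)` is a Lebesgue (standard probability) space: a probability space which is isomorphic
mod 0 to a Borel probability measure on the line (equivalently, to an interval with Lebesgue
measure together with at most countably many atoms). `ψ` is the inverse mod 0 of `φ`; it is
measurable with respect to the completion of `ν`. Completeness of `μ` itself is not required, so
that complete spaces and standard Borel probability spaces are both covered. -/
structure IsLebesgueSpace {Ω : Type*} [MeasurableSpace Ω] (μ : Measure Ω) : Prop where
  isProbabilityMeasure : IsProbabilityMeasure μ
  exists_iso : ∃ (ν : Measure ℝ) (φ : Ω → ℝ) (ψ : ℝ → Ω),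
    MeasurePreserving φ μ ν ∧ NullMeasurable ψ ν ∧
    (∀ᵐ ω ∂μ, ψ (φ ω) = ω) ∧ (∀ᵐ x ∂ν, φ (ψ x) = x)

/-- `T` is non-periodic: almost no point is fixed by a positive power of `T`. -/
def IsNonperiodic {Ω : Type*} [MeasurableSpace Ω] (T : Equiv.Perm Ω) (μ : Measure Ω) : Prop :=
  μ {ω | ∃ i : ℕ, 0 < i ∧ (T ^ i) ω = ω} = 0

/-- The partition into the level sets of `p` generates `T`: off a null set, distinct points have
distinct doubly infinite names `(p (T ^ k ω))`, `k ∈ ℤ`. -/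
def Generates {Ω α : Type*} [MeasurableSpace Ω] (T : Equiv.Perm Ω) (μ : Measure Ω)
    (p : Ω → α) : Prop :=
  ∃ Z : Set Ω, μ Z = 0 ∧ ∀ ω₁ ∉ Z, ∀ ω₂ ∉ Z,
    (∀ k : ℤ, p ((T ^ k) ω₁) = p ((T ^ k) ω₂)) → ω₁ = ω₂

/-- Off a null set: if the label at time `-1` is `n`, then the labels at times `-n, …, -1`
determine the label at time `0`. -/
def RecentPastDetermines {Ω : Type*} [MeasurableSpace Ω] (T : Equiv.Perm Ω) (μ : Measure Ω)
    (h : Ω → ℕ) : Prop :=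
  ∃ Z : Set Ω, μ Z = 0 ∧ ∀ ω₁ ∉ Z, ∀ ω₂ ∉ Z, ∀ n : ℕ,
    h (T⁻¹ ω₁) = n → h (T⁻¹ ω₂) = n →
    (∀ k : ℕ, 1 ≤ k → k ≤ n → h ((T ^ (-(k : ℤ))) ω₁) = h ((T ^ (-(k : ℤ))) ω₂)) →
    h ω₁ = h ω₂

/-- `h` labels by `1, 2, 3, …` the pieces of a countable measurable partition that generates `T`
and for which the label `n` at time `-1` tells how far to look back to determine the label at
time `0`. -/
structure IsLookbackGenerator {Ω : Type*} [MeasurableSpace Ω] (T : Equiv.Perm Ω)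
    (μ : Measure Ω) (h : Ω → ℕ) : Prop where
  measurable : Measurable h
  one_le : ∀ ω, 1 ≤ h ω
  generates : Generates T μ h
  determines : RecentPastDetermines T μ h

/-- Off a null set, the value of `p` determines the value of `q`. -/
def Determines {Ω α β : Type*} [MeasurableSpace Ω] (μ : Measure Ω)
    (p : Ω → α) (q : Ω → β) : Prop :=
  ∃ Z : Set Ω, μ Z = 0 ∧ ∀ ω₁ ∉ Z, ∀ ω₂ ∉ Z, p ω₁ = p ω₂ → q ω₁ = q ω₂

/-- Shannon entropy `∑ -μ(p = a) log μ(p = a)`, in `[0, ∞]`, of a countable partition. -/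
noncomputable def entropy {Ω α : Type*} [MeasurableSpace Ω] (μ : Measure Ω) (p : Ω → α) : ℝ≥0∞ :=
  ∑' a : α, ENNReal.ofReal (Real.negMulLog (μ.real (p ⁻¹' {a})))

/-- Conditional entropy of a countable partition given a sub-σ-algebra `m`: the expectation of
`∑ -μ(p = a | m) log μ(p = a | m)`, in `[0, ∞]`. -/
noncomputable def condEntropy {Ω α : Type*} [MeasurableSpace Ω] (μ : Measure Ω) (p : Ω → α)
    (m : MeasurableSpace Ω) : ℝ≥0∞ :=
  ∫⁻ ω, ∑' a : α, ENNReal.ofReal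
    (Real.negMulLog ((μ[(p ⁻¹' {a}).indicator (fun _ => (1 : ℝ)) | m]) ω)) ∂μ

/-- Entropy of the stationary process `(p ∘ T ^ k)`: the infimum (which is the limit) of
`H(p, p ∘ T, …, p ∘ T ^ (n - 1)) / n` over `n ≥ 1`. -/
noncomputable def processEntropy {Ω α : Type*} [MeasurableSpace Ω] (T : Equiv.Perm Ω)
    (μ : Measure Ω) (p : Ω → α) : ℝ≥0∞ :=
  ⨅ n : ℕ, entropy μ (fun ω (j : Fin (n + 1)) => p ((T ^ (j : ℕ)) ω)) / ((n + 1 : ℕ) : ℝ≥0∞)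

/-- The σ-algebra generated by the strict future `p ∘ T, p ∘ T ^ 2, …`. -/
abbrev futureSigma {Ω α : Type*} [MeasurableSpace α] (T : Equiv.Perm Ω) (p : Ω → α) :
    MeasurableSpace Ω :=
  ⨆ k : ℕ, MeasurableSpace.comap (fun ω => p ((T ^ (k + 1)) ω)) inferInstance

end Kalikow

/-! Take decreasing markers `B 0 = univ ⊇ B 1 ⊇ …` with null intersection, each visited by almost
every orbit arbitrarily far in both directions (`exists_vanishing_markers`, `exists_markers`). They
give each time `j` of an orbit a finite height, the largest `i` with `T ^ j ω ∈ B i`. The label at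
`j` codes the block from `j` to the next place at least as high, and for `c = 1` also the block back
to the previous such place. It records the heights there, the distances to the nearest higher
places, and the data `q 0, …, q i`, where `i` is the height of `j`.

For (*), let `p` be the last place before `j` that is higher than `j`. The next place as high as `p`
comes after `j`, so the blocks of `j` lie inside those of `p`, and the label at `p` determines the
label at `j` (`BlocksAgree.of_past`). The label at `j - 1` is built to exceed `j - p`, so `p` is
within reach (`blockCode_eq_of_past`). The labels generate because each place lies in blocks of
arbitrarily high places (`data_eq_of_blockCode_eq`). For `c = 1` everything is symmetric under time
reversal, which gives (c), hence (a).

For (b) take `c = 0` and every `q i = P`. The label then looks only ahead, except for the distances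
back to higher places. The future of `f = gapLabel`, which records at each marker visit the times
since the previous visits, supplies them: take the gap that ends at the next higher place and
subtract the distance to that place (`higher_eq_of_gapCode_eq`). By Kac's inequality the logarithm
of the return time to a rare marker has small integral, so `H(f) < ε`. The future of `h` is thus a
function of the future of `(P, f)`, and the chain rule with Cesàro averaging gives the entropy bound
(`processEntropy_le_condEntropy_add`).

Since `T⁻¹` need not be measurable for the given σ-algebra, the construction is carried out on the
completion and the labels are then changed on a null set. -/

namespace Kalikow

/-! ### Integer codes of finite words -/

/-- A code of the word `u 0, …, u (n - 1)`. -/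
def wordCode (u : ℕ → ℕ) : ℕ → ℕ
  | 0 => 0
  | n + 1 => Nat.pair (wordCode u n) (u n)

theorem wordCode_inj {u v : ℕ → ℕ} {n : ℕ} :
    wordCode u n = wordCode v n ↔ ∀ j < n, u j = v j := by
  induction n with
  | zero => simp [wordCode]
  | succ n ih =>
    rw [wordCode, wordCode, Nat.pair_eq_pair, ih]
    constructor
    · rintro ⟨h1, h2⟩ j hj
      rcases Nat.lt_succ_iff_lt_or_eq.1 hj with h | rfl
      · exact h1 j h
      · exact h2
    · intro h
      exact ⟨fun j hj => h j (by omega), h n (by omega)⟩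

theorem pair_succ_le {a b M : ℕ} (ha : a ≤ M) (hb : b ≤ M) : Nat.pair a b + 1 ≤ (M + 1) ^ 2 :=
  (Nat.pair_lt_max_add_one_sq a b).trans_le (Nat.pow_le_pow_left (by omega) 2)

/-- Each pairing at most squares the bound. The crude exponent is harmless: the markers are made
rare after it is known. -/
theorem wordCode_succ_le {u : ℕ → ℕ} {M n : ℕ} (hu : ∀ j < n, u j ≤ M) :
    wordCode u n + 1 ≤ (M + 1) ^ 2 ^ n := by
  induction n with
  | zero => simp [wordCode]
  | succ n ih =>
    have h1 := ih fun j hj => hu j (by omega)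
    have h2 : M + 1 ≤ (M + 1) ^ 2 ^ n := Nat.le_self_pow (by positivity) _
    have h3 := pair_succ_le (M := (M + 1) ^ 2 ^ n - 1) (a := wordCode u n) (b := u n) (by omega)
      (by have := hu n (by omega); omega)
    rw [Nat.sub_add_cancel (by omega), ← pow_mul, ← pow_succ] at h3
    exact h3

/-! ### Visits to high places of an integer sequence -/

/-- The number of steps from `j` to the next place where `x` is at least `i`. -/
noncomputable def nextVisit (x : ℤ → ℕ) (i : ℕ) (j : ℤ) : ℕ := sInf {k : ℕ | 1 ≤ k ∧ i ≤ x (j + k)}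

/-- The number of steps from `j` back to the previous place where `x` is at least `i`. -/
noncomputable def prevVisit (x : ℤ → ℕ) (i : ℕ) (j : ℤ) : ℕ := sInf {k : ℕ | 1 ≤ k ∧ i ≤ x (j - k)}

/-- Every height is reached arbitrarily far in both directions. -/
def IsRecurrent (x : ℤ → ℕ) : Prop :=
  ∀ (i : ℕ) (j : ℤ), (∃ k : ℕ, 1 ≤ k ∧ i ≤ x (j + k)) ∧ ∃ k : ℕ, 1 ≤ k ∧ i ≤ x (j - k)

theorem nextVisit_reflect (x : ℤ → ℕ) (i : ℕ) (j : ℤ) :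
    nextVisit (fun t => x (-t)) i j = prevVisit x i (-j) := by
  simp only [nextVisit, prevVisit, neg_add, sub_eq_add_neg]

theorem prevVisit_reflect (x : ℤ → ℕ) (i : ℕ) (j : ℤ) :
    prevVisit (fun t => x (-t)) i j = nextVisit x i (-j) := by
  simp only [nextVisit, prevVisit, neg_sub', sub_neg_eq_add]

theorem nextVisit_shift (x : ℤ → ℕ) (i : ℕ) (s j : ℤ) :
    nextVisit (fun t => x (t + s)) i j = nextVisit x i (j + s) := by
  simp only [nextVisit, add_right_comm]

theorem prevVisit_shift (x : ℤ → ℕ) (i : ℕ) (s j : ℤ) :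
    prevVisit (fun t => x (t + s)) i j = prevVisit x i (j + s) := by
  simp only [prevVisit, sub_add_eq_add_sub]

section Visits

variable {x x₁ x₂ : ℤ → ℕ} {i i' : ℕ} {j : ℤ} {k : ℕ}

theorem IsRecurrent.reflect (hx : IsRecurrent x) : IsRecurrent fun t => x (-t) := by
  intro i j
  obtain ⟨⟨k, hk, h⟩, l, hl, h'⟩ := hx i (-j)
  refine ⟨⟨l, hl, ?_⟩, k, hk, ?_⟩
  · simpa only [neg_add, ← sub_eq_add_neg] using h'
  · simpa only [neg_sub', sub_neg_eq_add] using h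

theorem IsRecurrent.nextVisit_spec (hx : IsRecurrent x) (i : ℕ) (j : ℤ) :
    1 ≤ nextVisit x i j ∧ i ≤ x (j + nextVisit x i j) :=
  Nat.sInf_mem (s := {k : ℕ | 1 ≤ k ∧ i ≤ x (j + k)}) (hx i j).1

theorem IsRecurrent.prevVisit_spec (hx : IsRecurrent x) (i : ℕ) (j : ℤ) :
    1 ≤ prevVisit x i j ∧ i ≤ x (j - prevVisit x i j) :=
  Nat.sInf_mem (s := {k : ℕ | 1 ≤ k ∧ i ≤ x (j - k)}) (hx i j).2

theorem nextVisit_le (hk : 1 ≤ k) (h : i ≤ x (j + k)) : nextVisit x i j ≤ k :=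
  Nat.sInf_le ⟨hk, h⟩

theorem prevVisit_le (hk : 1 ≤ k) (h : i ≤ x (j - k)) : prevVisit x i j ≤ k :=
  Nat.sInf_le ⟨hk, h⟩

theorem lt_of_lt_nextVisit (hk : 1 ≤ k) (h : k < nextVisit x i j) : x (j + k) < i := by
  by_contra hc
  exact absurd (nextVisit_le hk (not_lt.1 hc)) (not_le.2 h)

theorem lt_of_lt_prevVisit (hk : 1 ≤ k) (h : k < prevVisit x i j) : x (j - k) < i := by
  by_contra hc
  exact absurd (prevVisit_le hk (not_lt.1 hc)) (not_le.2 h)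

theorem nextVisit_congr (hk : 1 ≤ k) (h : i ≤ x₁ (j + k))
    (heq : ∀ t, j < t → t ≤ j + k → x₁ t = x₂ t) : nextVisit x₁ i j = nextVisit x₂ i j := by
  have key : ∀ y₁ y₂ : ℤ → ℕ, i ≤ y₁ (j + k) → (∀ t, j < t → t ≤ j + k → y₁ t = y₂ t) →
      nextVisit y₂ i j ≤ nextVisit y₁ i j := by
    intro y₁ y₂ h heq
    have hs : nextVisit y₁ i j ∈ {k : ℕ | 1 ≤ k ∧ i ≤ y₁ (j + k)} := Nat.sInf_mem ⟨k, hk, h⟩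
    have hle : nextVisit y₁ i j ≤ k := nextVisit_le hk h
    obtain ⟨h1, h2⟩ := hs
    exact nextVisit_le h1 (by rwa [← heq _ (by omega) (by omega)])
  refine le_antisymm (key x₂ x₁ ?_ fun t h1 h2 => (heq t h1 h2).symm) (key x₁ x₂ h heq)
  rwa [← heq _ (by omega) le_rfl]

theorem prevVisit_congr (hk : 1 ≤ k) (h : i ≤ x₁ (j - k))
    (heq : ∀ t, j - k ≤ t → t < j → x₁ t = x₂ t) : prevVisit x₁ i j = prevVisit x₂ i j := by
  have := nextVisit_congr (x₁ := fun t => x₁ (-t)) (x₂ := fun t => x₂ (-t)) (i := i) (j := -j) hk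
    (by rwa [neg_add, neg_neg, ← sub_eq_add_neg]) fun t h1 h2 => heq _ (by omega) (by omega)
  simpa only [nextVisit_reflect, neg_neg] using this

/-- The gap before the next visit measures how far back the last visit was. -/
theorem prevVisit_add_nextVisit (hx : IsRecurrent x) (hj : x j < i) :
    prevVisit x i (j + nextVisit x i j) = prevVisit x i j + nextVisit x i j := by
  obtain ⟨h1, h2⟩ := hx.prevVisit_spec i j
  obtain ⟨h3, h4⟩ := hx.nextVisit_spec i j
  obtain ⟨h5, h6⟩ := hx.prevVisit_spec i (j + nextVisit x i j)
  refine le_antisymm (prevVisit_le (by omega) ?_) ?_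
  · convert h2 using 2
    push_cast
    ring
  · by_contra! hc
    -- A closer previous visit would lie after `j`, at `j`, or between `j` and the last visit before
    -- `j`; each is excluded.
    rcases lt_trichotomy (prevVisit x i (j + nextVisit x i j)) (nextVisit x i j) with h | h | h
    · have := lt_of_lt_nextVisit (x := x) (i := i) (j := j)
        (k := nextVisit x i j - prevVisit x i (j + nextVisit x i j)) (by omega) (by omega)
      rw [Nat.cast_sub h.le, ← add_sub_assoc] at this
      omega
    · rw [h] at h6
      simp only [add_sub_cancel_right] at h6
      omega
    · have := lt_of_lt_prevVisit (x := x) (i := i) (j := j)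
        (k := prevVisit x i (j + nextVisit x i j) - nextVisit x i j) (by omega) (by omega)
      rw [Nat.cast_sub h.le, sub_sub_eq_add_sub] at this
      omega

end Visits

/-! ### Nested blocks and their codes -/

/-- The distance from `j` to the last earlier place that is higher than `j`. -/
noncomputable def lastHigher (x : ℤ → ℕ) (j : ℤ) : ℕ := prevVisit x (x j + 1) j

/-- The distance from `j` to the first later place that is higher than `j`. -/
noncomputable def nextHigher (x : ℤ → ℕ) (j : ℤ) : ℕ := nextVisit x (x j + 1) j

/-- At the place `j` the sequences have the same height and the same neighbouring blocks at that
height, including the data `q i` up to that height. The earlier block is included if `c = 1`,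
not if `c = 0`. -/
structure BlocksAgree (c : ℕ) (x₁ : ℤ → ℕ) (q₁ : ℕ → ℤ → ℕ) (x₂ : ℤ → ℕ) (q₂ : ℕ → ℤ → ℕ)
    (j : ℤ) : Prop where
  height : x₁ j = x₂ j
  prev : c * prevVisit x₁ (x₁ j) j = c * prevVisit x₂ (x₂ j) j
  next : nextVisit x₁ (x₁ j) j = nextVisit x₂ (x₂ j) j
  heights : ∀ t : ℤ, j - c * prevVisit x₁ (x₁ j) j ≤ t → t ≤ j + nextVisit x₁ (x₁ j) j →
    x₁ t = x₂ t
  lastHigher : ∀ t : ℤ, j - c * prevVisit x₁ (x₁ j) j ≤ t → t ≤ j + nextVisit x₁ (x₁ j) j →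
    lastHigher x₁ t = lastHigher x₂ t
  nextHigher : ∀ t : ℤ, j - c * prevVisit x₁ (x₁ j) j ≤ t → t ≤ j + nextVisit x₁ (x₁ j) j →
    nextHigher x₁ t = nextHigher x₂ t
  data : ∀ t : ℤ, j - c * prevVisit x₁ (x₁ j) j ≤ t → t ≤ j + nextVisit x₁ (x₁ j) j →
    ∀ i ≤ x₁ j, q₁ i t = q₂ i t

/-- An integer code of the blocks at `j`. -/
noncomputable def blockCode (c : ℕ) (x : ℤ → ℕ) (q : ℕ → ℤ → ℕ) (j : ℤ) : ℕ :=
  Nat.pair (lastHigher x (j + 1) + c * nextHigher x (j - 1))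
    (Nat.pair (x j) (Nat.pair (c * prevVisit x (x j) j) (Nat.pair (nextVisit x (x j) j)
      (wordCode (fun s => Nat.pair (x (j - (c * prevVisit x (x j) j : ℕ) + s))
        (Nat.pair (lastHigher x (j - (c * prevVisit x (x j) j : ℕ) + s))
        (Nat.pair (nextHigher x (j - (c * prevVisit x (x j) j : ℕ) + s))
        (wordCode (fun i => q i (j - (c * prevVisit x (x j) j : ℕ) + s)) (x j + 1)))))
        (c * prevVisit x (x j) j + nextVisit x (x j) j + 1))))) + 1

section Blocks

variable {c : ℕ} {x x₁ x₂ : ℤ → ℕ} {q q₁ q₂ : ℕ → ℤ → ℕ} {j : ℤ}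

theorem blockCode_shift (s : ℤ) : blockCode c (fun t => x (t + s)) (fun i t => q i (t + s)) j =
    blockCode c x q (j + s) := by
  have e1 : ∀ t, lastHigher (fun t => x (t + s)) t = lastHigher x (t + s) := fun t =>
    prevVisit_shift ..
  have e2 : ∀ t, nextHigher (fun t => x (t + s)) t = nextHigher x (t + s) := fun t =>
    nextVisit_shift ..
  simp only [blockCode, e1, e2, prevVisit_shift, nextVisit_shift, add_right_comm j _ s,
    sub_add_eq_add_sub]

theorem blocksAgree_of_blockCode_eq (h : blockCode c x₁ q₁ j = blockCode c x₂ q₂ j) :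
    BlocksAgree c x₁ q₁ x₂ q₂ j := by
  simp only [blockCode, add_left_inj, Nat.pair_eq_pair] at h
  obtain ⟨-, h1, h2, h3, h4⟩ := h
  rw [← h2, ← h3, wordCode_inj] at h4
  have key : ∀ t : ℤ, j - c * prevVisit x₁ (x₁ j) j ≤ t → t ≤ j + nextVisit x₁ (x₁ j) j →
      x₁ t = x₂ t ∧ lastHigher x₁ t = lastHigher x₂ t ∧ nextHigher x₁ t = nextHigher x₂ t ∧
      ∀ i ≤ x₁ j, q₁ i t = q₂ i t := by
    intro t ht ht'
    have := h4 (t - (j - c * prevVisit x₁ (x₁ j) j)).toNat (by push_cast [← Int.ofNat_lt]; omega)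
    rw [Int.toNat_of_nonneg (by omega)] at this
    simp only [Nat.pair_eq_pair, Nat.cast_mul, ← h1, add_sub_cancel, wordCode_inj] at this
    obtain ⟨e1, e2, e3, e4⟩ := this
    exact ⟨e1, e2, e3, fun i hi => e4 i (by omega)⟩
  exact ⟨h1, h2, h3, fun t h h' => (key t h h').1, fun t h h' => (key t h h').2.1,
    fun t h h' => (key t h h').2.2.1, fun t h h' => (key t h h').2.2.2⟩

theorem BlocksAgree.blockCode_eq (hx : IsRecurrent x₁) (hc : c = 0 ∨ c = 1)
    (h : BlocksAgree c x₁ q₁ x₂ q₂ j) : blockCode c x₁ q₁ j = blockCode c x₂ q₂ j := by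
  have hn := (hx.nextVisit_spec (x₁ j) j).1
  have hp := (hx.prevVisit_spec (x₁ j) j).1
  simp only [blockCode, add_left_inj, Nat.pair_eq_pair]
  rw [← h.prev, ← h.next, wordCode_inj]
  refine ⟨?_, h.height, rfl, rfl, fun s hs => ?_⟩
  · rw [h.lastHigher (j + 1) (by have := Nat.zero_le (c * prevVisit x₁ (x₁ j) j); omega)
      (by omega)]
    rcases hc with rfl | rfl
    · simp
    · rw [h.nextHigher (j - 1) (by omega) (by omega)]
  · have hs1 : j - c * prevVisit x₁ (x₁ j) j ≤ j - (c * prevVisit x₁ (x₁ j) j : ℕ) + s := by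
      push_cast; omega
    have hs2 : j - (c * prevVisit x₁ (x₁ j) j : ℕ) + s ≤ j + nextVisit x₁ (x₁ j) j := by omega
    rw [h.heights _ hs1 hs2, h.lastHigher _ hs1 hs2, h.nextHigher _ hs1 hs2, ← h.height]
    congr 3
    exact wordCode_inj.2 fun i hi => h.data _ hs1 hs2 i (by omega)

/-- This is why the code has its first component and its `+ 1`: the label at `j` must bound the
look-back distance needed at `j + 1`. -/
theorem lastHigher_lt_blockCode : lastHigher x (j + 1) < blockCode c x q j :=
  Nat.lt_succ_of_le ((Nat.le_add_right _ _).trans (Nat.left_le_pair _ _))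

theorem nextHigher_lt_blockCode : nextHigher x (j - 1) < blockCode 1 x q j :=
  Nat.lt_succ_of_le ((by omega : nextHigher x (j - 1) ≤ _ + 1 * nextHigher x (j - 1)).trans
    (Nat.left_le_pair _ _))

theorem BlocksAgree.reflect (h : BlocksAgree 1 x₁ q₁ x₂ q₂ j) :
    BlocksAgree 1 (fun t => x₁ (-t)) (fun i t => q₁ i (-t)) (fun t => x₂ (-t))
      (fun i t => q₂ i (-t)) (-j) where
  height := by simpa using h.height
  prev := by simpa [prevVisit_reflect] using h.next
  next := by simpa [nextVisit_reflect] using h.prev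
  heights t h1 h2 := by
    simp only [prevVisit_reflect, nextVisit_reflect, neg_neg] at h1 h2
    exact h.heights _ (by omega) (by omega)
  lastHigher t h1 h2 := by
    simp only [prevVisit_reflect, nextVisit_reflect, neg_neg] at h1 h2
    simp only [Kalikow.lastHigher, prevVisit_reflect]
    exact h.nextHigher _ (by omega) (by omega)
  nextHigher t h1 h2 := by
    simp only [prevVisit_reflect, nextVisit_reflect, neg_neg] at h1 h2
    simp only [Kalikow.nextHigher, nextVisit_reflect]
    exact h.lastHigher _ (by omega) (by omega)
  data t h1 h2 i hi := by
    simp only [prevVisit_reflect, nextVisit_reflect, neg_neg] at h1 h2 hi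
    exact h.data _ (by omega) (by omega) i hi

/-- Blocks that agree at `p` agree at all lower places up to the next place as high as `p`. -/
theorem BlocksAgree.sub (hx : IsRecurrent x₁) (hc : c = 0 ∨ c = 1) {p : ℤ}
    (h : BlocksAgree c x₁ q₁ x₂ q₂ p) (hpj : p < j) (hj : j < p + nextVisit x₁ (x₁ p) p)
    (hlt : x₁ j < x₁ p) : BlocksAgree c x₁ q₁ x₂ q₂ j := by
  have h0 : (0 : ℤ) ≤ c * prevVisit x₁ (x₁ p) p := by positivity
  have hj12 : x₁ j = x₂ j := h.heights j (by omega) (by omega)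
  obtain ⟨u, rfl⟩ : ∃ u : ℕ, j = p + u := ⟨(j - p).toNat, by omega⟩
  obtain ⟨v, hv⟩ : ∃ v : ℕ, nextVisit x₁ (x₁ p) p = u + v :=
    ⟨nextVisit x₁ (x₁ p) p - u, by omega⟩
  have hlast := (hx.nextVisit_spec (x₁ p) p).2
  rw [hv] at hlast hj
  -- Both `p` and the end of its forward block are higher than `j`, so they confine the blocks of
  -- `j`.
  have hlast' : x₁ (p + u) ≤ x₁ (p + u + v) := by
    rw [Nat.cast_add, ← add_assoc] at hlast; omega
  have hfirst : x₁ (p + u) ≤ x₁ (p + u - u) := by rw [add_sub_cancel_right]; omega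
  have hN : nextVisit x₁ (x₁ (p + u)) (p + u) ≤ v := nextVisit_le (by omega) hlast'
  have hP : prevVisit x₁ (x₁ (p + u)) (p + u) ≤ u := prevVisit_le (by omega) hfirst
  have hcP : c * prevVisit x₁ (x₁ (p + u)) (p + u) ≤ u := by
    rcases hc with rfl | rfl <;> omega
  have hcP' : (c * prevVisit x₁ (x₁ (p + u)) (p + u) : ℤ) ≤ u := by exact_mod_cast hcP
  exact
  { height := hj12
    prev := by
      rw [← hj12, prevVisit_congr (by omega) hfirst fun t h1 h2 => h.heights t _ _] <;> omega
    next := by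
      rw [← hj12]
      exact nextVisit_congr (by omega) hlast' fun t h1 h2 => h.heights t (by omega) (by omega)
    heights := fun t h1 h2 => h.heights t (by omega) (by omega)
    lastHigher := fun t h1 h2 => h.lastHigher t (by omega) (by omega)
    nextHigher := fun t h1 h2 => h.nextHigher t (by omega) (by omega)
    data := fun t h1 h2 i hi => h.data t (by omega) (by omega) i (by omega) }

/-- A place lies in the block of the last earlier place that is at least as high as `i`,
if it is lower than `i` itself. -/
theorem lt_nextVisit_of_prevVisit (hx : IsRecurrent x) {i : ℕ} (hj : x j < i) :
    prevVisit x i j < nextVisit x (x (j - prevVisit x i j)) (j - prevVisit x i j) := by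
  have h1 := hx.prevVisit_spec i j
  have h2 := hx.nextVisit_spec (x (j - prevVisit x i j)) (j - prevVisit x i j)
  by_contra! hc
  rcases hc.lt_or_eq with hlt | heq
  · have := lt_of_lt_prevVisit (x := x) (i := i) (j := j) (k := prevVisit x i j -
      nextVisit x (x (j - prevVisit x i j)) (j - prevVisit x i j)) (by omega) (by omega)
    rw [Nat.cast_sub hc, sub_sub_eq_add_sub, add_sub_right_comm] at this
    omega
  · rw [heq, sub_add_cancel] at h2
    omega

/-- No place strictly between the last higher place and `j` is higher than `j`, so `j` is still
inside the forward block of that higher place and its own blocks are nested there. -/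
theorem BlocksAgree.of_past (hx : IsRecurrent x₁) (hc : c = 0 ∨ c = 1)
    (h : BlocksAgree c x₁ q₁ x₂ q₂ (j - Kalikow.lastHigher x₁ j)) :
    BlocksAgree c x₁ q₁ x₂ q₂ j := by
  have h1 := hx.prevVisit_spec (x₁ j + 1) j
  have h2 := lt_nextVisit_of_prevVisit hx (i := x₁ j + 1) (j := j) (by omega)
  unfold Kalikow.lastHigher at h
  exact h.sub hx hc (by omega) (by omega) (by omega)

/-- If the code at `j - 1` is `n`, the codes at `j - n, …, j - 1` determine the code at `j`. -/
theorem blockCode_eq_of_past (hx : IsRecurrent x₁) (hc : c = 0 ∨ c = 1) {n : ℕ}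
    (hn : blockCode c x₁ q₁ (j - 1) = n)
    (h : ∀ k : ℕ, 1 ≤ k → k ≤ n → blockCode c x₁ q₁ (j - k) = blockCode c x₂ q₂ (j - k)) :
    blockCode c x₁ q₁ j = blockCode c x₂ q₂ j := by
  -- The code at `j - 1` exceeds the distance back to the last place higher than `j`, so that place
  -- is among those read.
  have hlt := lastHigher_lt_blockCode (c := c) (x := x₁) (q := q₁) (j := j - 1)
  rw [sub_add_cancel, hn] at hlt
  have h1 : 1 ≤ lastHigher x₁ j := (hx.prevVisit_spec (x₁ j + 1) j).1
  exact ((blocksAgree_of_blockCode_eq (h _ h1 hlt.le)).of_past hx hc).blockCode_eq hx hc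

/-- If the code at `j + 1` is `n`, the codes at `j + 1, …, j + n` determine the code at `j`. -/
theorem blockCode_eq_of_future (hx : IsRecurrent x₁) {n : ℕ}
    (hn : blockCode 1 x₁ q₁ (j + 1) = n)
    (h : ∀ k : ℕ, 1 ≤ k → k ≤ n → blockCode 1 x₁ q₁ (j + k) = blockCode 1 x₂ q₂ (j + k)) :
    blockCode 1 x₁ q₁ j = blockCode 1 x₂ q₂ j := by
  have hlt := nextHigher_lt_blockCode (x := x₁) (q := q₁) (j := j + 1)
  rw [add_sub_cancel_right, hn] at hlt
  have h1 : 1 ≤ nextHigher x₁ j := (hx.nextVisit_spec (x₁ j + 1) j).1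
  have h2 := (blocksAgree_of_blockCode_eq (h _ h1 hlt.le)).reflect
  have h3 : -(j + (nextHigher x₁ j : ℤ)) = -j - lastHigher (fun t => x₁ (-t)) (-j) := by
    simp only [Kalikow.lastHigher, prevVisit_reflect, neg_neg, Kalikow.nextHigher]
    ring
  rw [h3] at h2
  have h4 := (h2.of_past hx.reflect (Or.inr rfl)).reflect
  simp only [neg_neg] at h4
  exact h4.blockCode_eq hx (Or.inr rfl)

/-- The doubly infinite sequence of codes determines the data. -/
theorem data_eq_of_blockCode_eq (hx : IsRecurrent x₁)
    (h : ∀ k : ℤ, blockCode c x₁ q₁ k = blockCode c x₂ q₂ k) (i : ℕ) : q₁ i j = q₂ i j := by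
  have h0 : ∀ p : ℤ, (0 : ℤ) ≤ c * prevVisit x₁ (x₁ p) p := fun p => by positivity
  -- A place too low to record `q i` itself is covered by the forward block of the last earlier
  -- place of height at least `i`.
  by_cases hj : x₁ j < i
  · have h1 := hx.prevVisit_spec i j
    have h2 := lt_nextVisit_of_prevVisit hx hj
    have h3 := h0 (j - prevVisit x₁ i j)
    exact (blocksAgree_of_blockCode_eq (h (j - prevVisit x₁ i j))).data j (by omega) (by omega) i
      h1.2
  · have h3 := h0 j
    exact (blocksAgree_of_blockCode_eq (h j)).data j (by omega) (by omega) i (by omega)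

theorem data_zero_eq_of_blockCode_eq (h : blockCode c x₁ q₁ j = blockCode c x₂ q₂ j) :
    q₁ 0 j = q₂ 0 j := by
  have h0 : (0 : ℤ) ≤ c * prevVisit x₁ (x₁ j) j := by positivity
  exact (blocksAgree_of_blockCode_eq h).data j (by omega) (by omega) 0 (Nat.zero_le _)

/-! ### Gap codes: recovering the past from the future -/

/-- A code of the height at `j` and of the gaps that end at `j`. -/
noncomputable def gapCode (x : ℤ → ℕ) (j : ℤ) : ℕ :=
  Nat.pair (x j) (wordCode (fun i => prevVisit x (i + 1) j) (x j))

theorem gapCode_shift (s : ℤ) : gapCode (fun t => x (t + s)) j = gapCode x (j + s) := by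
  simp only [gapCode, prevVisit_shift]

theorem gapCode_eq_iff : gapCode x₁ j = gapCode x₂ j ↔
    x₁ j = x₂ j ∧ ∀ i < x₁ j, prevVisit x₁ (i + 1) j = prevVisit x₂ (i + 1) j := by
  rw [gapCode, gapCode, Nat.pair_eq_pair]
  refine and_congr_right fun h => ?_
  rw [← h, wordCode_inj]

/-- The next higher place is visible in the heights ahead. The gap recorded there at level `x₁ j +
1` is the sum of the distances from `j` to the higher places on both sides, so subtraction gives the
distance back. -/
theorem higher_eq_of_gapCode_eq (hx₁ : IsRecurrent x₁) (hx₂ : IsRecurrent x₂)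
    (h : ∀ t, j ≤ t → t ≤ j + nextHigher x₁ j → gapCode x₁ t = gapCode x₂ t) :
    lastHigher x₁ j = lastHigher x₂ j ∧ nextHigher x₁ j = nextHigher x₂ j := by
  have hj := (gapCode_eq_iff.1 (h j le_rfl (by omega))).1
  have hs := hx₁.nextVisit_spec (x₁ j + 1) j
  have hn : nextHigher x₁ j = nextHigher x₂ j := by
    rw [nextHigher, nextHigher, ← hj]
    exact nextVisit_congr hs.1 hs.2 fun t h1 h2 => (gapCode_eq_iff.1 (h t h1.le h2)).1
  refine ⟨?_, hn⟩
  have h1 := prevVisit_add_nextVisit hx₁ (i := x₁ j + 1) (j := j) (by omega)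
  have h2 := prevVisit_add_nextVisit hx₂ (i := x₂ j + 1) (j := j) (by omega)
  have h3 := (gapCode_eq_iff.1 (h (j + nextHigher x₁ j) (by omega) le_rfl)).2 (x₁ j) hs.2
  unfold nextHigher at hn h3
  unfold lastHigher
  rw [← hj] at hn h2 ⊢
  rw [← hn] at h2
  omega

/-- How far one has to look ahead of `j` to see the blocks at `j`. -/
noncomputable def lookAhead (x : ℤ → ℕ) (j : ℤ) : ℕ :=
  nextVisit x (x j) j +
    ∑ s ∈ Finset.range (nextVisit x (x j) j + 1), nextHigher x (j + s) + 1

/-- With `c = 0` only the `lastHigher` entries refer to the past. They are recovered from gap codes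
ahead, at a finite distance bounded by `lookAhead`. -/
theorem blockCode_eq_of_gapCode_eq (hx₁ : IsRecurrent x₁) (hx₂ : IsRecurrent x₂)
    (h : ∀ t, j ≤ t → t < j + lookAhead x₁ j → gapCode x₁ t = gapCode x₂ t)
    (hq : ∀ t, j ≤ t → t < j + lookAhead x₁ j → ∀ i, q₁ i t = q₂ i t) :
    blockCode 0 x₁ q₁ j = blockCode 0 x₂ q₂ j := by
  have hN : nextVisit x₁ (x₁ j) j < lookAhead x₁ j := by unfold lookAhead; omega
  have hh : ∀ t, j ≤ t → t ≤ j + nextVisit x₁ (x₁ j) j → x₁ t = x₂ t := fun t h1 h2 =>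
    (gapCode_eq_iff.1 (h t h1 (by omega))).1
  have hs := hx₁.nextVisit_spec (x₁ j) j
  have hb : ∀ t, j ≤ t → t ≤ j + nextVisit x₁ (x₁ j) j →
      lastHigher x₁ t = lastHigher x₂ t ∧ nextHigher x₁ t = nextHigher x₂ t := by
    intro t h1 h2
    obtain ⟨s, rfl⟩ : ∃ s : ℕ, t = j + s := ⟨(t - j).toNat, by omega⟩
    have h3 : nextHigher x₁ (j + s) ≤
        ∑ s ∈ Finset.range (nextVisit x₁ (x₁ j) j + 1), nextHigher x₁ (j + s) :=
      Finset.single_le_sum (f := fun s : ℕ => nextHigher x₁ (j + s)) (fun _ _ => Nat.zero_le _)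
        (Finset.mem_range.2 (by omega))
    refine higher_eq_of_gapCode_eq hx₁ hx₂ fun t h4 h5 => h t (by omega) ?_
    unfold lookAhead
    omega
  refine BlocksAgree.blockCode_eq hx₁ (Or.inl rfl) ⟨hh j le_rfl (by omega), by simp, ?_, ?_, ?_,
    ?_, ?_⟩
  · rw [← hh j le_rfl (by omega)]
    exact nextVisit_congr hs.1 hs.2 fun t h1 h2 => hh t h1.le h2
  · intro t h1 h2
    exact hh t (by simpa using h1) h2
  · intro t h1 h2
    exact (hb t (by simpa using h1) h2).1
  · intro t h1 h2
    exact (hb t (by simpa using h1) h2).2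
  · intro t h1 h2 i _
    exact hq t (by simpa using h1) (by omega) i

end Blocks

/-! ### Conditional entropy of countable partitions -/

section Entropy

open Filter Topology Real

variable {Ω α β : Type*} {m m₁ m₂ m0 : MeasurableSpace Ω} {μ : Measure Ω}

theorem entropy_equiv (e : α ≃ β) (X : Ω → α) :
    entropy μ (fun ω => e (X ω)) = entropy μ X := by
  rw [entropy, ← e.tsum_eq]
  refine tsum_congr fun a => ?_
  congr 3
  ext ω
  simp

theorem entropy_of_unique [IsProbabilityMeasure μ] [Unique α] (X : Ω → α) : entropy μ X = 0 := by
  rw [entropy, tsum_eq_single default fun a h => absurd (Unique.eq_default a) h]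
  have : X ⁻¹' {default} = Set.univ := by
    ext ω
    simpa using Unique.eq_default _
  simp [this]

theorem entropy_comp [MeasurableSpace α] [MeasurableSingletonClass α] {T : Ω → Ω}
    (hT : MeasurePreserving T μ μ) {X : Ω → α} (hX : Measurable X) :
    entropy μ (fun ω => X (T ω)) = entropy μ X := by
  refine tsum_congr fun a => ?_
  rw [show (fun ω => X (T ω)) ⁻¹' {a} = T ⁻¹' (X ⁻¹' {a}) from rfl, measureReal_def,
    hT.measure_preimage (hX (measurableSet_singleton a)).nullMeasurableSet, ← measureReal_def]

/-- The contribution of the set `A` to conditional entropy given `m`. -/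
noncomputable def condTerm (μ : Measure Ω) (A : Set Ω) (m : MeasurableSpace Ω) : ℝ≥0∞ :=
  ∫⁻ ω, ENNReal.ofReal (negMulLog ((μ[A.indicator (fun _ => (1 : ℝ)) | m]) ω)) ∂μ

theorem condEntropy_eq_tsum [Countable α] {X : Ω → α} (hm : m ≤ m0) :
    condEntropy μ X m = ∑' a, condTerm μ (X ⁻¹' {a}) m := by
  refine lintegral_tsum fun a => ?_
  exact (ENNReal.measurable_ofReal.comp (continuous_negMulLog.measurable.comp
    (stronglyMeasurable_condExp.mono hm).measurable)).aemeasurable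

variable [Countable α] [MeasurableSpace α] [MeasurableSingletonClass α]
  [Countable β] [MeasurableSpace β] [MeasurableSingletonClass β] [IsProbabilityMeasure μ]

theorem condExp_indicator_mem {A : Set Ω} (hA : MeasurableSet A) (m : MeasurableSpace Ω) :
    ∀ᵐ ω ∂μ, 0 ≤ (μ[A.indicator (fun _ => (1 : ℝ)) | m]) ω ∧
      (μ[A.indicator (fun _ => (1 : ℝ)) | m]) ω ≤ 1 := by
  by_cases hm : m ≤ m0
  · have hi : Integrable (A.indicator (fun _ => (1 : ℝ))) μ :=
      (integrable_const (1 : ℝ)).indicator hA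
    have h1 : 0 ≤ᵐ[μ] μ[A.indicator (fun _ => (1 : ℝ)) | m] :=
      condExp_nonneg (Eventually.of_forall fun ω => Set.indicator_nonneg (by simp) ω)
    have h2 : μ[A.indicator (fun _ => (1 : ℝ)) | m] ≤ᵐ[μ] μ[fun _ => (1 : ℝ) | m] :=
      condExp_mono hi (integrable_const 1) (Eventually.of_forall fun ω =>
        Set.indicator_le_self' (by simp) ω)
    rw [condExp_const hm] at h2
    filter_upwards [h1, h2] with ω h1 h2 using ⟨h1, h2⟩
  · simp [condExp_of_not_le hm]

theorem negMulLog_le_one {x : ℝ} (h : 0 ≤ x) : negMulLog x ≤ 1 :=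
  (negMulLog_le_one_sub_self h).trans (by linarith)

/-- The information on one set decreases with the σ-algebra. -/
theorem condTerm_anti {A : Set Ω} (hA : MeasurableSet A)
    (h12 : m₁ ≤ m₂) (h2 : m₂ ≤ m0) : condTerm μ A m₂ ≤ condTerm μ A m₁ := by
  set Y := μ[A.indicator (fun _ => (1 : ℝ)) | m₂] with hY
  have hint : ∀ m ≤ m0, Integrable (negMulLog ∘ μ[A.indicator (fun _ => (1 : ℝ)) | m]) μ := by
    intro m hm
    refine Integrable.of_bound (C := 1) (continuous_negMulLog.measurable.comp
      (stronglyMeasurable_condExp.mono hm).measurable).aestronglyMeasurable ?_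
    filter_upwards [condExp_indicator_mem (μ := μ) hA m] with ω h
    rw [Function.comp_apply, norm_of_nonneg (negMulLog_nonneg h.1 h.2)]
    exact negMulLog_le_one h.1
  have hnn : ∀ m, 0 ≤ᵐ[μ] negMulLog ∘ μ[A.indicator (fun _ => (1 : ℝ)) | m] := by
    intro m
    filter_upwards [condExp_indicator_mem (μ := μ) hA m] with ω h
    exact negMulLog_nonneg h.1 h.2
  have e : ∀ m ≤ m0, condTerm μ A m =
      ENNReal.ofReal (∫ ω, (negMulLog ∘ μ[A.indicator (fun _ => (1 : ℝ)) | m]) ω ∂μ) :=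
    fun m hm => (ofReal_integral_eq_lintegral_ofReal (hint m hm) (hnn m)).symm
  rw [e m₂ h2, e m₁ (h12.trans h2)]
  refine ENNReal.ofReal_le_ofReal ?_
  rw [← integral_condExp (h12.trans h2) (f := negMulLog ∘ μ[A.indicator (fun _ => (1 : ℝ)) | m₂])]
  refine integral_mono_ae integrable_condExp (hint m₁ (h12.trans h2)) ?_
  -- Conditional Jensen for the concave function `negMulLog`; the tower property then identifies the
  -- inner conditional expectation.
  have hJ := ConcaveOn.condExp_map_le (h12.trans h2) (μ := μ) (f := Y) concaveOn_negMulLog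
    (continuous_negMulLog.upperSemicontinuous.upperSemicontinuousOn _)
    ((condExp_indicator_mem (μ := μ) hA m₂).mono fun ω h => h.1) isClosed_Ici
    integrable_condExp (hint m₂ h2)
  filter_upwards [hJ, condExp_condExp_of_le (μ := μ) (f := A.indicator (fun _ => (1 : ℝ)))
    h12 h2] with ω h3 h4
  refine h3.trans (le_of_eq ?_)
  rw [Function.comp_apply, hY, h4, Function.comp_apply]

theorem condTerm_bot {A : Set Ω} (hA : MeasurableSet A) :
    condTerm μ A ⊥ = ENNReal.ofReal (negMulLog (μ.real A)) := by
  simp [condTerm, condExp_bot, integral_indicator hA]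

theorem condEntropy_anti {X : Ω → α} (hX : Measurable X)
    (h12 : m₁ ≤ m₂) (h2 : m₂ ≤ m0) : condEntropy μ X m₂ ≤ condEntropy μ X m₁ := by
  rw [condEntropy_eq_tsum h2, condEntropy_eq_tsum (h12.trans h2)]
  exact ENNReal.tsum_le_tsum fun a => condTerm_anti (hX (measurableSet_singleton a)) h12 h2

theorem condEntropy_bot {X : Ω → α} (hX : Measurable X) : condEntropy μ X ⊥ = entropy μ X := by
  rw [condEntropy_eq_tsum bot_le]
  exact tsum_congr fun a => condTerm_bot (hX (measurableSet_singleton a))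

theorem condEntropy_le_entropy {X : Ω → α} (hX : Measurable X)
    (hm : m ≤ m0) : condEntropy μ X m ≤ entropy μ X :=
  (condEntropy_anti hX bot_le hm).trans_eq (condEntropy_bot hX)

theorem tendsto_condTerm {A : Set Ω} (hA : MeasurableSet A) (F : Filtration ℕ m0) :
    Tendsto (fun n => condTerm μ A (F n)) atTop (𝓝 (condTerm μ A (⨆ n, F n))) := by
  refine tendsto_lintegral_of_dominated_convergence (fun _ => 1) (fun n => ?_) (fun n => ?_)
    (by simp) ?_
  · exact ENNReal.measurable_ofReal.comp (continuous_negMulLog.measurable.comp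
      (stronglyMeasurable_condExp.mono (F.le n)).measurable)
  · filter_upwards [condExp_indicator_mem (μ := μ) hA (F n)] with ω h
    exact ENNReal.ofReal_le_one.2 (negMulLog_le_one h.1)
  · filter_upwards [tendsto_ae_condExp (μ := μ) (ℱ := F) (A.indicator (fun _ => (1 : ℝ)))]
      with ω h
    exact ENNReal.tendsto_ofReal ((continuous_negMulLog.tendsto _).comp h)

/-- Conditional entropy is continuous along an increasing sequence of σ-algebras. -/
theorem tendsto_condEntropy {X : Ω → α} (hX : Measurable X) (hfin : entropy μ X < ∞)
    (F : Filtration ℕ m0) :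
    Tendsto (fun n => condEntropy μ X (F n)) atTop (𝓝 (condEntropy μ X (⨆ n, F n))) := by
  simp only [condEntropy_eq_tsum (F.le _), condEntropy_eq_tsum (iSup_le F.le)]
  -- Dominated convergence for the sum over labels, with the terms of the finite entropy of `X` as
  -- dominating function.
  simp only [← lintegral_count]
  refine tendsto_lintegral_of_dominated_convergence
    (fun a => ENNReal.ofReal (negMulLog (μ.real (X ⁻¹' {a})))) (fun n => ?_) (fun n => ?_) ?_ ?_
  · exact measurable_of_countable _
  · refine Eventually.of_forall fun a => ?_
    change _ ≤ ENNReal.ofReal (negMulLog (μ.real (X ⁻¹' {a})))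
    rw [← condTerm_bot (hX (measurableSet_singleton a))]
    exact condTerm_anti (hX (measurableSet_singleton a)) bot_le (F.le n)
  · rw [lintegral_count]
    exact hfin.ne
  · exact Eventually.of_forall fun a => tendsto_condTerm (hX (measurableSet_singleton a)) F

/-- Null sets do not matter for conditional expectations. -/
theorem condExp_eventuallyMeasurableSpace (hm : m ≤ m0) {f : Ω → ℝ}
    (hf : Integrable f μ) :
    μ[f | m] =ᵐ[μ] μ[f | eventuallyMeasurableSpace m (ae μ) ⊓ m0] := by
  refine ae_eq_condExp_of_forall_setIntegral_eq inf_le_right hf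
    (fun s _ _ => integrable_condExp.integrableOn) (fun s hs _ => ?_) ?_
  · obtain ⟨t, ht, hst⟩ := hs.1
    rw [setIntegral_congr_set hst, setIntegral_congr_set hst, setIntegral_condExp hm hf ht]
  · exact (stronglyMeasurable_condExp.mono
      (le_inf le_eventuallyMeasurableSpace hm)).aestronglyMeasurable

/-- Adjoining null sets to `m₂` does not change conditional expectations, after which monotonicity
in the σ-algebra applies. -/
theorem condEntropy_le_of_le_eventually {X : Ω → α} (hX : Measurable X)
    (h1 : m₁ ≤ m0) (h2 : m₂ ≤ m0) (h : m₁ ≤ eventuallyMeasurableSpace m₂ (ae μ)) :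
    condEntropy μ X m₂ ≤ condEntropy μ X m₁ := by
  refine le_trans (le_of_eq ?_) (condEntropy_anti hX (le_inf h h1) inf_le_right)
  rw [condEntropy_eq_tsum h2, condEntropy_eq_tsum inf_le_right]
  refine tsum_congr fun a => lintegral_congr_ae ?_
  filter_upwards [condExp_eventuallyMeasurableSpace h2
    ((integrable_const (1 : ℝ)).indicator (hX (measurableSet_singleton a)))] with ω hω
  simp only [hω]

/-- The chain rule. -/
theorem entropy_prod {X : Ω → α} {S : Ω → β} (hX : Measurable X) (hS : Measurable S) :
    entropy μ (fun ω => (X ω, S ω)) =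
      entropy μ S + condEntropy μ X (MeasurableSpace.comap S inferInstance) := by
  have hfac : ∀ a, ∃ g : β → ℝ, μ[(X ⁻¹' {a}).indicator (fun _ => (1 : ℝ)) |
      MeasurableSpace.comap S inferInstance] = g ∘ S := fun a => by
    obtain ⟨g, -, hg⟩ := (stronglyMeasurable_condExp (μ := μ)
      (f := (X ⁻¹' {a}).indicator (fun _ => (1 : ℝ)))
      (m := MeasurableSpace.comap S inferInstance)).measurable.exists_eq_measurable_comp
    exact ⟨g, hg⟩
  choose g hg using hfac
  have hmeas : ∀ a s, MeasurableSet (X ⁻¹' {a} ∩ S ⁻¹' {s}) := fun a s =>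
    (hX (measurableSet_singleton a)).inter (hS (measurableSet_singleton s))
  have hprod : ∀ a s, μ.real (X ⁻¹' {a} ∩ S ⁻¹' {s}) = μ.real (S ⁻¹' {s}) * g a s := by
    intro a s
    have h1 := setIntegral_condExp hS.comap_le (μ := μ) (s := S ⁻¹' {s})
      ((integrable_const (1 : ℝ)).indicator (hX (measurableSet_singleton a)))
      ⟨{s}, measurableSet_singleton s, rfl⟩
    rw [hg] at h1
    change ∫ ω in S ⁻¹' {s}, g a (S ω) ∂μ = _ at h1
    rw [setIntegral_congr_fun (g := fun _ => g a s) (hS (measurableSet_singleton s))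
      (fun ω hω => congrArg (g a) hω), setIntegral_const,
      integral_indicator (hX (measurableSet_singleton a)), setIntegral_const,
      measureReal_restrict_apply (hX (measurableSet_singleton a))] at h1
    simpa using h1.symm
  have hsum : ∀ s, ∑' a, ENNReal.ofReal (μ.real (X ⁻¹' {a} ∩ S ⁻¹' {s})) = μ (S ⁻¹' {s}) := by
    intro s
    simp only [ofReal_measureReal (measure_ne_top μ _)]
    rw [← measure_iUnion]
    · congr 1
      ext ω
      simp
    · intro a b hab
      refine Set.disjoint_left.2 fun ω h1 h2 => hab ?_
      rw [← show X ω = a from h1.1, ← show X ω = b from h2.1]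
    · exact fun a => hmeas a s
  have hcond : condEntropy μ X (MeasurableSpace.comap S inferInstance) =
      ∑' s, ∑' a, ENNReal.ofReal (μ.real (S ⁻¹' {s}) * negMulLog (g a s)) := by
    rw [condEntropy]
    simp only [hg, Function.comp_apply]
    rw [← lintegral_map (f := fun s => ∑' a, ENNReal.ofReal (negMulLog (g a s)))
      (measurable_of_countable _) hS, lintegral_countable']
    refine tsum_congr fun s => ?_
    rw [Measure.map_apply hS (measurableSet_singleton s), ← ENNReal.tsum_mul_right]
    refine tsum_congr fun a => ?_
    rw [ENNReal.ofReal_mul measureReal_nonneg, ofReal_measureReal, mul_comm]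
  have hpre : ∀ a s, (fun ω => (X ω, S ω)) ⁻¹' {(a, s)} = X ⁻¹' {a} ∩ S ⁻¹' {s} := by
    intro a s
    ext ω
    simp
  rw [entropy, ENNReal.tsum_prod', ENNReal.tsum_comm, hcond, entropy, ← ENNReal.tsum_add]
  refine tsum_congr fun s => ?_
  set p := μ.real (S ⁻¹' {s}) with hp
  have hp1 : p ≤ 1 := measureReal_le_one
  have hlog : 0 ≤ -log p := by
    have := log_nonpos measureReal_nonneg hp1
    linarith
  -- The term of `S = s` is distributed over the values of `X`, so that the chain rule can be
  -- checked cell by cell.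
  have hS' : ENNReal.ofReal (negMulLog p) =
      ∑' a, ENNReal.ofReal (μ.real (X ⁻¹' {a} ∩ S ⁻¹' {s}) * -log p) := by
    simp only [ENNReal.ofReal_mul measureReal_nonneg]
    rw [ENNReal.tsum_mul_right, hsum, negMulLog, neg_mul_comm,
      ENNReal.ofReal_mul measureReal_nonneg, hp, ofReal_measureReal]
  rw [hS', ← ENNReal.tsum_add]
  refine tsum_congr fun a => ?_
  rw [hpre, hprod]
  -- On a null fibre `g a s` is not known to lie in `[0, 1]`, but all terms vanish.
  rcases (measureReal_nonneg : 0 ≤ p).eq_or_lt with h0 | h0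
  · clear_value p
    rw [← hp] at h0 ⊢
    simp [← h0]
  · have hg0 : 0 ≤ g a s := by
      have := hprod a s ▸ (measureReal_nonneg : 0 ≤ μ.real (X ⁻¹' {a} ∩ S ⁻¹' {s}))
      exact nonneg_of_mul_nonneg_right this h0
    have hg1 : g a s ≤ 1 := by
      have h1 : μ.real (X ⁻¹' {a} ∩ S ⁻¹' {s}) ≤ p := measureReal_mono Set.inter_subset_right
      rw [hprod] at h1
      nlinarith
    rw [← ENNReal.ofReal_add, negMulLog_mul]
    · congr 1
      simp only [negMulLog, ← hp]
      ring
    · exact mul_nonneg (mul_nonneg h0.le hg0) hlog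
    · exact mul_nonneg h0.le (negMulLog_nonneg hg0 hg1)

theorem entropy_le_entropy_prod {X : Ω → α} {S : Ω → β} (hX : Measurable X) (hS : Measurable S) :
    entropy μ S ≤ entropy μ (fun ω => (X ω, S ω)) := by
  rw [entropy_prod hX hS]
  exact le_self_add

theorem entropy_prod_le {X : Ω → α} {S : Ω → β} (hX : Measurable X) (hS : Measurable S) :
    entropy μ (fun ω => (X ω, S ω)) ≤ entropy μ S + entropy μ X := by
  rw [entropy_prod hX hS]
  gcongr
  exact condEntropy_le_entropy hX hS.comap_le

end Entropy

/-! ### Process entropy and the future -/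

section StationaryEntropy

open Filter Topology

variable {Ω : Type*} {m m0 : MeasurableSpace Ω} {μ : Measure Ω} {T : Equiv.Perm Ω}

theorem measurePreserving_pow (hT : MeasurePreserving T μ μ) (n : ℕ) :
    MeasurePreserving (⇑(T ^ n)) μ μ := by
  rw [Equiv.Perm.coe_pow]
  exact hT.iterate n

/-- The first `n` labels of the process `R` from time `k` on. -/
def window {γ : Type*} (T : Equiv.Perm Ω) (R : Ω → γ) (k n : ℕ) (ω : Ω) (i : Fin n) : γ :=
  R ((T ^ ((i : ℕ) + k)) ω)

theorem measurable_window {γ : Type*} [MeasurableSpace γ] (hT : MeasurePreserving T μ μ)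
    {R : Ω → γ} (hR : Measurable R) (k n : ℕ) : Measurable (window T R k n) :=
  measurable_pi_lambda _ fun _ => hR.comp (measurePreserving_pow hT _).measurable

/-- The σ-algebras of the finite futures. -/
def futureFiltration {γ : Type*} [MeasurableSpace γ] (hT : MeasurePreserving T μ μ)
    {R : Ω → γ} (hR : Measurable R) : Filtration ℕ m0 where
  seq n := MeasurableSpace.comap (window T R 1 n) inferInstance
  mono' m n hmn := by
    refine Measurable.comap_le ?_
    refine @measurable_pi_lambda _ _ _ (_) _ _ fun i => ?_
    exact (measurable_pi_apply (X := fun _ : Fin n => γ) (⟨i, i.2.trans_le hmn⟩ : Fin n)).comp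
      (comap_measurable (window T R 1 n))
  le' n := (measurable_window hT hR 1 n).comap_le

theorem iSup_futureFiltration {γ : Type*} [MeasurableSpace γ] (hT : MeasurePreserving T μ μ)
    {R : Ω → γ} (hR : Measurable R) :
    ⨆ n, futureFiltration hT hR n = futureSigma T R := by
  refine le_antisymm (iSup_le fun n => ?_) (iSup_le fun k => ?_)
  · refine Measurable.comap_le ?_
    refine @measurable_pi_lambda _ _ _ (_) _ _ fun i => ?_
    exact (comap_measurable (fun ω => R ((T ^ ((i : ℕ) + 1)) ω))).mono
      (le_iSup (fun k : ℕ => MeasurableSpace.comap (fun ω => R ((T ^ (k + 1)) ω)) inferInstance)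
        (i : ℕ)) le_rfl
  · refine le_trans ?_ (le_iSup _ (k + 1))
    refine Measurable.comap_le ?_
    exact (measurable_pi_apply (⟨k, k.lt_succ_self⟩ : Fin (k + 1))).comp
      (comap_measurable (window T R 1 (k + 1)))

/-- A countable-valued function that is determined, off a null set, by finitely many terms of a
sequence is measurable with respect to that sequence, up to null sets. -/
theorem comap_le_eventuallyMeasurableSpace {γ δ : Type*} [Countable γ] [MeasurableSpace γ]
    [MeasurableSingletonClass γ] [MeasurableSpace δ] {S : ℕ → Ω → γ}
    (hS : ∀ n, Measurable[m] (S n)) {g : Ω → δ} {Z : Set Ω} (hZ : μ Z = 0)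
    (h : ∀ ω₁ ∉ Z, ∃ N : ℕ, ∀ ω₂ ∉ Z, (∀ k < N, S k ω₁ = S k ω₂) → g ω₁ = g ω₂) :
    MeasurableSpace.comap g inferInstance ≤ eventuallyMeasurableSpace m (ae μ) := by
  rintro _ ⟨A, -, rfl⟩
  let C : (Σ N : ℕ, Fin N → γ) → Set Ω := fun w => {ω | ∀ k : Fin w.1, S k ω = w.2 k}
  -- The approximating set is the union of the cylinders on which `g` lies in `A` off `Z`.
  -- Dependence on finitely many terms keeps this union countable, and no measurability of `A` is
  -- needed.
  refine ⟨⋃ w ∈ {w | ∀ ω ∉ Z, ω ∈ C w → g ω ∈ A}, C w, ?_, ?_⟩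
  · refine MeasurableSet.biUnion (Set.to_countable _) fun w _ => ?_
    have : C w = ⋂ k : Fin w.1, S k ⁻¹' {w.2 k} := by
      ext ω
      simp [C]
    rw [this]
    exact MeasurableSet.iInter fun k => hS k (measurableSet_singleton _)
  · have hZ' : ∀ᵐ ω ∂μ, ω ∉ Z := measure_eq_zero_iff_ae_notMem.1 hZ
    filter_upwards [hZ'] with ω hω
    refine propext ⟨fun hA => ?_, fun hU => ?_⟩
    · obtain ⟨N, hN⟩ := h ω hω
      refine Set.mem_iUnion₂.2 ⟨⟨N, fun k => S k ω⟩, fun ω' hω' hC => ?_, fun k => rfl⟩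
      change g ω ∈ A at hA
      rwa [← hN ω' hω' fun k hk => (hC ⟨k, hk⟩).symm]
    · obtain ⟨w, hw, hC⟩ := Set.mem_iUnion₂.1 hU
      exact hw ω hω hC

variable [IsProbabilityMeasure μ]

/-- Split off time `0`: it adds at most `H(f)` and the entropy of `P` given the next `n` pairs, and
by stationarity those pairs have the entropy of the window of length `n` from time `0`. -/
theorem entropy_window_le {P f : Ω → ℕ} (hT : MeasurePreserving T μ μ) (hP : Measurable P)
    (hf : Measurable f) (n : ℕ) : entropy μ (window T (fun ω => (P ω, f ω)) 0 n) ≤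
      ∑ j ∈ Finset.range n,
        (entropy μ f + condEntropy μ P (futureFiltration hT (hP.prodMk hf) j)) := by
  induction n with
  | zero => simp [entropy_of_unique]
  | succ n ih =>
    set R := fun ω => (P ω, f ω) with hRdef
    have hR : Measurable R := hP.prodMk hf
    have hw := measurable_window hT hR 1 n
    have h1 : entropy μ (window T R 0 (n + 1)) =
        entropy μ (fun ω => (f ω, (P ω, window T R 1 n ω))) := by
      rw [← entropy_equiv ((Equiv.prodAssoc ℕ ℕ (Fin n → ℕ × ℕ)).symm.trans
        (((Equiv.prodComm ℕ ℕ).prodCongr (Equiv.refl _)).trans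
          (Fin.consEquiv fun _ => ℕ × ℕ))) (fun ω => (f ω, (P ω, window T R 1 n ω)))]
      congr 1
      ext1 ω
      ext1 i
      refine Fin.cases ?_ (fun i => ?_) i
      · simp [window, hRdef]
      · simp [window, hRdef, Fin.consEquiv]
    have h2 : entropy μ (window T R 1 n) = entropy μ (window T R 0 n) := by
      rw [← entropy_comp hT (measurable_window hT hR 0 n)]
      congr 1
    rw [h1, Finset.sum_range_succ]
    refine (entropy_prod_le hf (hP.prodMk hw)).trans ?_
    rw [entropy_prod hP hw, h2, add_assoc, add_comm _ (entropy μ f)]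
    exact add_le_add_left ih _

/-- If the future of `h` is a function of the future of `(P, f)`, up to null sets, then given
the future of `h` the entropy of `P` exceeds that of the process `P`, up to that of `f`. -/
theorem processEntropy_le_condEntropy_add {P f h : Ω → ℕ} (hT : MeasurePreserving T μ μ)
    (hP : Measurable P) (hf : Measurable f) (hh : Measurable h) (hfin : entropy μ P < ∞)
    (hle : futureSigma T h ≤
      eventuallyMeasurableSpace (futureSigma T fun ω => (P ω, f ω)) (ae μ)) :
    processEntropy T μ P ≤ condEntropy μ P (futureSigma T h) + entropy μ f := by
  have hR : Measurable fun ω => (P ω, f ω) := hP.prodMk hf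
  set F := futureFiltration hT hR with hF
  have hfut : ∀ {γ : Type} [MeasurableSpace γ] {R : Ω → γ}, Measurable R →
      futureSigma T R ≤ m0 := fun hR => by
    rw [← iSup_futureFiltration hT hR]
    exact iSup_le (futureFiltration hT hR).le
  refine le_trans ?_ (add_le_add_left (condEntropy_le_of_le_eventually hP (hfut hh) (hfut hR) hle)
    _)
  rcases eq_or_ne (entropy μ f) ∞ with hinf | hffin
  · simp [hinf]
  have hx : ∀ m ≤ m0, entropy μ f + condEntropy μ P m ≠ ∞ := fun m hm =>
    ENNReal.add_ne_top.2 ⟨hffin, ((condEntropy_le_entropy hP hm).trans_lt hfin).ne⟩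
  rw [← iSup_futureFiltration hT hR, add_comm, ← ENNReal.ofReal_toReal (hx _ (iSup_le F.le))]
  have hlim : Tendsto (fun n => (entropy μ f + condEntropy μ P (F n)).toReal) atTop
      (𝓝 (entropy μ f + condEntropy μ P (⨆ n, F n)).toReal) :=
    (ENNReal.tendsto_toReal (hx _ (iSup_le F.le))).comp
      ((tendsto_condEntropy hP hfin F).const_add _)
  -- The conditional entropies given finite futures converge, hence so do their Cesàro means, and
  -- each mean dominates a term of the infimum.
  refine ge_of_tendsto ((ENNReal.tendsto_ofReal hlim.cesaro).comp (tendsto_add_atTop_nat 1))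
    (Eventually.of_forall fun n => ?_)
  refine (iInf_le _ n).trans ?_
  have h1 : entropy μ (fun ω (j : Fin (n + 1)) => P ((T ^ (j : ℕ)) ω)) ≤
      entropy μ (window T (fun ω => (P ω, f ω)) 0 (n + 1)) := by
    refine (entropy_le_entropy_prod (measurable_window hT hf 0 (n + 1))
      (measurable_window hT hP 0 (n + 1))).trans_eq ?_
    rw [← entropy_equiv ((Equiv.prodComm _ _).trans
      (Equiv.arrowProdEquivProdArrow (Fin (n + 1)) (fun _ => ℕ) (fun _ => ℕ)).symm)]
    rfl
  have h2 := h1.trans (entropy_window_le hT hP hf (n + 1))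
  rw [Function.comp_apply, ENNReal.ofReal_mul (by positivity),
    ← ENNReal.toReal_sum fun i _ => hx _ (F.le i),
    ENNReal.ofReal_toReal (ENNReal.sum_ne_top.2 fun i _ => hx _ (F.le i)),
    ENNReal.ofReal_inv_of_pos (by positivity), ENNReal.ofReal_natCast, ENNReal.div_eq_inv_mul]
  gcongr

end StationaryEntropy

/-! ### The inverse of `T` up to null sets -/

section Inverse

open Filter Topology

variable {Ω : Type*} [MeasurableSpace Ω] {μ : Measure Ω} {T : Equiv.Perm Ω}

/-- In a Lebesgue space the image of a measurable set under an injective measure-preserving map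
contains a measurable set that is as large. -/
theorem IsLebesgueSpace.exists_subset_image (hμ : IsLebesgueSpace μ)
    (hT : MeasurePreserving T μ μ) {A : Set Ω} (hA : NullMeasurableSet A μ) :
    ∃ C, MeasurableSet C ∧ C ⊆ T '' A ∧ μ A ≤ μ C := by
  obtain ⟨A, hAA, hAm, hAe⟩ := hA.exists_measurable_subset_ae_eq
  obtain ⟨ν, φ, ψ, hφ, hψ, h1, h2⟩ := hμ.exists_iso
  obtain ⟨Z, hZ, hZm, hZ0⟩ := exists_measurable_superset_of_null (ae_iff.1 h1)
  have hZ' : ∀ ω ∉ Z, ψ (φ ω) = ω := fun ω hω => by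
    by_contra hc
    exact hω (hZ hc)
  have hG : ∀ᵐ ω ∂μ, ω ∉ Z ∧ T ω ∉ Z := by
    have h0 : ∀ᵐ ω ∂μ, ω ∉ Z := measure_eq_zero_iff_ae_notMem.1 hZ0
    exact h0.and (hT.quasiMeasurePreserving.ae h0)
  have hGm : MeasurableSet {ω | ω ∉ Z ∧ T ω ∉ Z} := hZm.compl.inter (hT.measurable hZm.compl)
  have hθ : NullMeasurable (fun x => φ (T (ψ x))) ν := fun s hs =>
    hψ ((hφ.measurable.comp hT.measurable) hs)
  obtain ⟨θ, hθm, hθe⟩ := hθ.aemeasurable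
  have hψG : ∀ᵐ x ∂ν, ψ x ∉ Z ∧ T (ψ x) ∉ Z := by
    have h3 : NullMeasurableSet (ψ ⁻¹' {ω | ω ∉ Z ∧ T ω ∉ Z}ᶜ) ν := hψ hGm.compl
    change ν (ψ ⁻¹' {ω | ω ∉ Z ∧ T ω ∉ Z}ᶜ) = 0
    rw [← hφ.measure_preimage h3]
    change ∀ᵐ ω ∂μ, ψ (φ ω) ∉ Z ∧ T (ψ (φ ω)) ∉ Z
    filter_upwards [h1, hG] with ω h4 h5
    rwa [h4]
  have hE : ∀ᵐ x ∂ν, φ (T (ψ x)) = θ x ∧ (ψ x ∉ Z ∧ T (ψ x) ∉ Z) ∧ φ (ψ x) = x :=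
    hθe.and (hψG.and h2)
  have hEA : NullMeasurableSet ({x | φ (T (ψ x)) = θ x ∧ (ψ x ∉ Z ∧ T (ψ x) ∉ Z) ∧
      φ (ψ x) = x} ∩ ψ ⁻¹' A) ν :=
    NullMeasurableSet.inter (NullMeasurableSet.of_compl (NullMeasurableSet.of_null hE)) (hψ hAm)
  obtain ⟨B, hBsub, hBm, hBe⟩ := hEA.exists_measurable_subset_ae_eq
  have hinj : Set.InjOn θ B := by
    intro x hx y hy hxy
    obtain ⟨⟨hx1, ⟨hx2, hx3⟩, hx4⟩, -⟩ := hBsub hx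
    obtain ⟨⟨hy1, ⟨hy2, hy3⟩, hy4⟩, -⟩ := hBsub hy
    rw [← hx1, ← hy1] at hxy
    have h3 := congrArg ψ hxy
    rw [hZ' _ hx3, hZ' _ hy3] at h3
    rw [← hx4, ← hy4, T.injective h3]
  -- `θ` is a Borel version of `φ ∘ T ∘ ψ`, injective on `B`, so its image of `B` is Borel by the
  -- Lusin–Souslin theorem.
  have hCm : MeasurableSet (φ ⁻¹' (θ '' B) \ Z) :=
    (hφ.measurable (hBm.image_of_measurable_injOn hθm hinj)).diff hZm
  refine ⟨φ ⁻¹' (θ '' B) \ Z, hCm, ?_, ?_⟩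
  · rintro ω ⟨⟨x, hx, hxω⟩, hω⟩
    obtain ⟨⟨hx1, ⟨hx2, hx3⟩, hx4⟩, hxA⟩ := hBsub hx
    rw [← hx1] at hxω
    have h3 := congrArg ψ hxω
    rw [hZ' _ hx3, hZ' _ hω] at h3
    exact ⟨ψ x, hAA hxA, h3⟩
  · rw [← measure_congr hAe, ← hT.measure_preimage hCm.nullMeasurableSet]
    have h3 : μ A = ν (ψ ⁻¹' A) := by
      rw [← hφ.measure_preimage (hψ hAm)]
      refine measure_congr ?_
      filter_upwards [h1] with ω hω
      change (ω ∈ A) = (ψ (φ ω) ∈ A)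
      rw [hω]
    have h4 : ν (ψ ⁻¹' A) ≤ ν B := by
      rw [measure_congr hBe]
      refine measure_mono_ae ?_
      filter_upwards [hE] with x hx hxA using ⟨hx, hxA⟩
    rw [h3]
    refine h4.trans ?_
    rw [← hφ.measure_preimage hBm.nullMeasurableSet]
    refine measure_mono_ae ?_
    filter_upwards [hG] with ω hω hωB
    obtain ⟨⟨hx1, -, -⟩, -⟩ := hBsub hωB
    rw [hZ' _ hω.1] at hx1
    exact ⟨⟨φ ω, hωB, hx1.symm⟩, hω.2⟩

/-- As `T` is bijective, the images of `A` and `Aᶜ` are complementary. Large measurable subsets of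
both images squeeze `T '' A` between measurable sets of equal measure. -/
theorem IsLebesgueSpace.image_perm (hμ : IsLebesgueSpace μ)
    (hT : MeasurePreserving T μ μ) {A : Set Ω} (hA : NullMeasurableSet A μ) :
    NullMeasurableSet (T '' A) μ ∧ μ (T '' A) = μ A := by
  have := hμ.isProbabilityMeasure
  obtain ⟨C, hCm, hC, hAC⟩ := hμ.exists_subset_image hT hA
  obtain ⟨D, hDm, hD, hAD⟩ := hμ.exists_subset_image hT hA.compl
  have h1 : μ (T '' A) ≤ μ A := by
    calc μ (T '' A) ≤ μ Dᶜ := by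
          refine measure_mono fun ω hω hωD => ?_
          have := hD hωD
          rw [Set.image_compl_eq T.bijective] at this
          exact this hω
      _ = 1 - μ D := prob_compl_eq_one_sub hDm
      _ ≤ 1 - μ Aᶜ := tsub_le_tsub_left hAD 1
      _ = μ A := by
          rw [prob_compl_eq_one_sub₀ hA, ENNReal.sub_sub_cancel ENNReal.one_ne_top prob_le_one]
  have h2 : C =ᵐ[μ] T '' A :=
    ae_eq_of_subset_of_measure_ge hC (h1.trans hAC) hCm.nullMeasurableSet (measure_ne_top μ _)
  exact ⟨hCm.nullMeasurableSet.congr h2, le_antisymm h1 (hAC.trans (measure_mono hC))⟩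

theorem measurePreserving_completion {S : Ω → Ω}
    (h : ∀ A, NullMeasurableSet A μ → NullMeasurableSet (S ⁻¹' A) μ ∧ μ (S ⁻¹' A) = μ A) :
    MeasurePreserving (α := NullMeasurableSpace Ω μ) (β := NullMeasurableSpace Ω μ) S
      μ.completion μ.completion := by
  have hm : Measurable (α := NullMeasurableSpace Ω μ) (β := NullMeasurableSpace Ω μ) S :=
    fun A hA => (h A hA).1
  refine ⟨hm, Measure.ext fun A hA => ?_⟩
  rw [Measure.map_apply hm hA]
  exact (h A hA).2

theorem IsLebesgueSpace.measurePreserving_completion (hμ : IsLebesgueSpace μ)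
    (hT : MeasurePreserving T μ μ) :
    MeasurePreserving (α := NullMeasurableSpace Ω μ) (β := NullMeasurableSpace Ω μ) T
      μ.completion μ.completion ∧
    MeasurePreserving (α := NullMeasurableSpace Ω μ) (β := NullMeasurableSpace Ω μ) ⇑T⁻¹
      μ.completion μ.completion := by
  refine ⟨Kalikow.measurePreserving_completion fun A hA =>
    ⟨hA.preimage hT.quasiMeasurePreserving, hT.measure_preimage hA⟩,
    Kalikow.measurePreserving_completion fun A hA => ?_⟩
  have : ⇑T⁻¹ ⁻¹' A = T '' A := (T.image_eq_preimage_symm A).symm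
  rw [this]
  exact hμ.image_perm hT hA

end Inverse

theorem zpow_zpow_apply {Ω : Type*} (T : Equiv.Perm Ω) (j k : ℤ) (ω : Ω) :
    (T ^ j) ((T ^ k) ω) = (T ^ (j + k)) ω := by
  rw [zpow_add, Equiv.Perm.mul_apply]

/-! ### Vanishing markers, return times and small entropy -/

section Markers

open Filter Topology

variable {Ω : Type*} [MeasurableSpace Ω] {μ : Measure Ω} {T : Equiv.Perm Ω}

theorem measurePreserving_zpow (hT : MeasurePreserving T μ μ) (hT' : MeasurePreserving ⇑T⁻¹ μ μ)
    (k : ℤ) : MeasurePreserving (⇑(T ^ k)) μ μ := by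
  rcases k.eq_nat_or_neg with ⟨n, rfl | rfl⟩
  · rw [zpow_natCast]
    exact measurePreserving_pow hT n
  · rw [zpow_neg, zpow_natCast, ← inv_pow]
    exact measurePreserving_pow hT' n

theorem ae_orbit (hT : MeasurePreserving T μ μ) (hT' : MeasurePreserving ⇑T⁻¹ μ μ)
    {p : Ω → Prop} (hp : ∀ᵐ ω ∂μ, p ω) : ∀ᵐ ω ∂μ, ∀ k : ℤ, p ((T ^ k) ω) :=
  ae_all_iff.2 fun k => (measurePreserving_zpow hT hT' k).quasiMeasurePreserving.ae hp

/-- The orbit of `ω` visits `A` arbitrarily far in both directions. -/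
def VisitsOften (T : Equiv.Perm Ω) (A : Set Ω) (ω : Ω) : Prop :=
  ∀ j : ℤ, (∃ k : ℕ, 1 ≤ k ∧ (T ^ (j + k)) ω ∈ A) ∧ ∃ k : ℕ, 1 ≤ k ∧ (T ^ (j - k)) ω ∈ A

/-- Poincaré recurrence in both directions. -/
theorem ae_visitsOften [IsFiniteMeasure μ] (hT : MeasurePreserving T μ μ)
    (hT' : MeasurePreserving ⇑T⁻¹ μ μ) {A : Set Ω} (hA : MeasurableSet A) :
    ∀ᵐ ω ∂μ, (∃ k : ℤ, (T ^ k) ω ∈ A) → VisitsOften T A ω := by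
  have h1 := ae_orbit hT hT' (hT.conservative.ae_mem_imp_frequently_image_mem hA.nullMeasurableSet)
  have h2 := ae_orbit hT hT' (hT'.conservative.ae_mem_imp_frequently_image_mem hA.nullMeasurableSet)
  filter_upwards [h1, h2] with ω h1 h2
  rintro ⟨k, hk⟩ j
  constructor
  · obtain ⟨n, hn, hnA⟩ := frequently_atTop.1 (h1 k hk) ((j - k).toNat + 1)
    rw [← Equiv.Perm.coe_pow, ← zpow_natCast, zpow_zpow_apply] at hnA
    refine ⟨(n + k - j).toNat, by omega, ?_⟩
    rwa [show j + ((n + k - j).toNat : ℤ) = n + k by omega]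
  · obtain ⟨n, hn, hnA⟩ := frequently_atTop.1 (h2 k hk) ((k - j).toNat + 1)
    rw [← Equiv.Perm.coe_pow, inv_pow, ← zpow_natCast, ← zpow_neg, zpow_zpow_apply] at hnA
    refine ⟨(n - k + j).toNat, by omega, ?_⟩
    rwa [show j - ((n - k + j).toNat : ℤ) = -n + k by omega]

/-- Vanishing markers: sets with null intersection each of which meets almost every orbit. -/
theorem exists_vanishing_markers [IsProbabilityMeasure μ] (hT : MeasurePreserving T μ μ)
    (hT' : MeasurePreserving ⇑T⁻¹ μ μ) (hper : IsNonperiodic T μ) {φ : Ω → ℝ} (hφ : Measurable φ)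
    {Z : Set Ω} (hZ : μ Z = 0) (hinj : Set.InjOn φ Zᶜ) :
    ∃ V : ℕ → Set Ω, Antitone V ∧ (∀ n, MeasurableSet (V n)) ∧ μ (⋂ n, V n) = 0 ∧
      ∀ᵐ ω ∂μ, ∀ n, VisitsOften T (V n) ω := by
  -- The exponential makes the coordinate bounded below, so that it has an infimum `m` on every
  -- orbit. The markers consist of the points that nearly attain this infimum.
  set g : Ω → ℝ := fun ω => Real.exp (φ ω) with hg
  have hgm : Measurable g := Real.measurable_exp.comp hφ
  set m : Ω → ℝ := fun ω => ⨅ k : ℤ, g ((T ^ k) ω) with hm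
  have hmm : Measurable m :=
    Measurable.iInf fun k => hgm.comp (measurePreserving_zpow hT hT' k).measurable
  have hbdd : ∀ ω, BddBelow (Set.range fun k : ℤ => g ((T ^ k) ω)) := fun ω =>
    ⟨0, by rintro _ ⟨k, rfl⟩; exact (Real.exp_pos _).le⟩
  have hminv : ∀ ω (j : ℤ), m ((T ^ j) ω) = m ω := by
    intro ω j
    simp only [hm, zpow_zpow_apply]
    exact (Equiv.addRight j).iInf_congr fun k => rfl
  have hmle : ∀ ω, m ω ≤ g ω := fun ω => by
    simpa using ciInf_le (hbdd ω) 0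
  set V : ℕ → Set Ω := fun n => {ω | g ω < m ω + 1 / ((n : ℝ) + 1)} with hV
  have hVm : ∀ n, MeasurableSet (V n) := fun n => measurableSet_lt hgm (hmm.add_const _)
  have hVinter : ∀ ω ∈ ⋂ n, V n, g ω = m ω := by
    intro ω hω
    refine le_antisymm (le_of_forall_pos_lt_add fun ε hε => ?_) (hmle ω)
    obtain ⟨n, hn⟩ := exists_nat_one_div_lt hε
    exact (Set.mem_iInter.1 hω n : g ω < _).trans (by gcongr)
  refine ⟨V, ?_, hVm, ?_, ae_all_iff.2 fun n => ?_⟩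
  · intro a b hab ω hω
    refine (show g ω < _ from hω).trans_le ?_
    gcongr
  · have hnp : ∀ᵐ ω ∂μ, ω ∉ {ω | ∃ i : ℕ, 0 < i ∧ (T ^ i) ω = ω} :=
      measure_eq_zero_iff_ae_notMem.1 hper
    have hZ' : ∀ᵐ ω ∂μ, ω ∉ Z := measure_eq_zero_iff_ae_notMem.1 hZ
    refine measure_eq_zero_iff_ae_notMem.2 ?_
    filter_upwards [hnp, ae_orbit hT hT' hZ',
      ae_visitsOften hT hT' (MeasurableSet.iInter hVm)] with ω h1 h2 h3 hω
    obtain ⟨k, hk, hkV⟩ := (h3 ⟨0, by simpa using hω⟩ 0).1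
    refine h1 ⟨k, hk, ?_⟩
    -- A point in all markers attains the infimum, and so does its return; injectivity makes the two
    -- equal, against non-periodicity.
    have h4 : g ((T ^ (0 + k : ℤ)) ω) = g ω := by
      rw [hVinter _ hkV, hVinter _ hω, hminv]
    have h5 := hinj (h2 (0 + k)) (by simpa using h2 0) (Real.exp_injective h4)
    simpa using h5
  · filter_upwards [ae_visitsOften hT hT' (hVm n)] with ω hω
    refine hω ?_
    obtain ⟨k, hk⟩ := exists_lt_of_ciInf_lt (show (⨅ k : ℤ, g ((T ^ k) ω)) < m ω + 1 / ((n : ℝ) + 1)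
      from lt_add_of_pos_right _ (by positivity))
    refine ⟨k, ?_⟩
    change g _ < m _ + _
    rwa [hminv]

/-- The time of the last earlier visit to `A`. -/
noncomputable def lastVisit (T : Equiv.Perm Ω) (A : Set Ω) (ω : Ω) : ℕ :=
  sInf {k : ℕ | 1 ≤ k ∧ (T ^ (-(k : ℤ))) ω ∈ A}

theorem measurable_sInf_nat {p : ℕ → Ω → Prop} (hp : ∀ k, MeasurableSet {ω | p k ω}) :
    Measurable fun ω => sInf {k | p k ω} := by
  refine measurable_of_Ici fun n => ?_
  rcases Nat.eq_zero_or_pos n with rfl | hn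
  · simp
  · have : (fun ω => sInf {k | p k ω}) ⁻¹' Set.Ici n =
        (⋃ k, {ω | p k ω}) ∩ ⋂ k ∈ Set.Iio n, {ω | p k ω}ᶜ := by
      ext ω
      simp only [Set.mem_preimage, Set.mem_Ici, Set.mem_inter_iff, Set.mem_iUnion,
        Set.mem_ofPred_eq, Set.mem_iInter, Set.mem_Iio, Set.mem_compl_iff]
      constructor
      · intro h
        have hne : {k | p k ω}.Nonempty := Nat.nonempty_of_pos_sInf (hn.trans_le h)
        exact ⟨hne, fun k hk hpk => by
          have := Nat.sInf_le (s := {k | p k ω}) hpk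
          omega⟩
      · rintro ⟨hne, h⟩
        by_contra! hc
        exact h _ hc (Nat.sInf_mem hne)
    rw [this]
    exact (MeasurableSet.iUnion hp).inter
      (MeasurableSet.biInter (Set.to_countable _) fun k _ => (hp k).compl)

theorem measurable_lastVisit (hT : MeasurePreserving T μ μ) (hT' : MeasurePreserving ⇑T⁻¹ μ μ)
    {A : Set Ω} (hA : MeasurableSet A) : Measurable (lastVisit T A) :=
  measurable_sInf_nat fun _ => (MeasurableSet.const _).inter
    ((measurePreserving_zpow hT hT' _).measurable hA)

/-- An inequality of Kac: the mean return time is at most `1 / μ A`. -/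
theorem lintegral_lastVisit_le [IsProbabilityMeasure μ] (hT : MeasurePreserving T μ μ)
    (hT' : MeasurePreserving ⇑T⁻¹ μ μ) {A : Set Ω} (hA : MeasurableSet A) :
    ∫⁻ ω in A, (lastVisit T A ω : ℝ≥0∞) ∂μ ≤ 1 := by
  have hr := measurable_lastVisit hT hT' hA
  have hs : ∀ j : ℕ, MeasurableSet {ω | j < lastVisit T A ω} := fun j => hr measurableSet_Ioi
  have h1 : ∀ ω, (lastVisit T A ω : ℝ≥0∞) =
      ∑' j : ℕ, {ω | j < lastVisit T A ω}.indicator (fun _ => (1 : ℝ≥0∞)) ω := by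
    intro ω
    rw [tsum_eq_sum (s := Finset.range (lastVisit T A ω))]
    · have : ∀ j ∈ Finset.range (lastVisit T A ω),
          {ω | j < lastVisit T A ω}.indicator (fun _ => (1 : ℝ≥0∞)) ω = 1 := fun j hj =>
        Set.indicator_of_mem (s := {ω | j < lastVisit T A ω}) (Finset.mem_range.1 hj) _
      rw [Finset.sum_congr rfl this]
      simp
    · intro j hj
      exact Set.indicator_of_notMem (s := {ω | j < lastVisit T A ω})
        (fun h => hj (Finset.mem_range.2 h)) _
  simp only [h1]
  rw [lintegral_tsum fun j => (measurable_const.indicator (hs j)).aemeasurable]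
  have h2 : ∀ j : ℕ, ∫⁻ ω in A, {ω | j < lastVisit T A ω}.indicator (fun _ => (1 : ℝ≥0∞)) ω ∂μ =
      μ (⇑(T ^ j) ⁻¹' ({ω | j < lastVisit T A ω} ∩ A)) := by
    intro j
    rw [lintegral_indicator_const (hs j), one_mul, Measure.restrict_apply (hs j),
      (measurePreserving_pow hT j).measure_preimage ((hs j).inter hA).nullMeasurableSet]
  simp only [h2]
  rw [← measure_iUnion]
  · exact prob_le_one
  -- Disjointness: a visit at time `i < j` makes the time since the last visit, seen at `j`, at most
  -- `j - i`.
  · have key : ∀ (i j : ℕ) (ω : Ω), i < j → (T ^ i) ω ∈ A → j < lastVisit T A ((T ^ j) ω) →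
        False := by
      intro i j ω hij hi hj
      refine absurd (Nat.sInf_le (s := {k : ℕ | 1 ≤ k ∧ (T ^ (-(k : ℤ))) ((T ^ j) ω) ∈ A})
        (m := j - i) ⟨by omega, ?_⟩) (by unfold lastVisit at hj; omega)
      rw [← zpow_natCast T j, zpow_zpow_apply, Nat.cast_sub hij.le,
        show -((j : ℤ) - i) + j = i by ring, zpow_natCast]
      exact hi
    intro i j hij
    refine Set.disjoint_left.2 fun ω hi hj => ?_
    rcases hij.lt_or_gt with h | h
    · exact key i j ω h hi.2 hj.1
    · exact key j i ω h hj.2 hi.1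
  · exact fun j => (measurePreserving_pow hT j).measurable ((hs j).inter hA)

/-- The tangent to the logarithm at `exp s`, raised by `1`; large `s` makes the slope small. -/
theorem log_le_mul_exp_neg_add {y : ℝ} (hy : 0 < y) (s : ℝ) :
    Real.log y ≤ y * Real.exp (-s) + s := by
  have := Real.log_le_sub_one_of_pos (mul_pos hy (Real.exp_pos (-s)))
  rw [Real.log_mul hy.ne' (Real.exp_pos _).ne', Real.log_exp] at this
  linarith

/-- The integral of the logarithm of the return time to a small set is small. -/
theorem exists_lintegral_log_lastVisit_le [IsProbabilityMeasure μ] (hT : MeasurePreserving T μ μ)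
    (hT' : MeasurePreserving ⇑T⁻¹ μ μ) {V : ℕ → Set Ω} (hV : Antitone V)
    (hVm : ∀ n, MeasurableSet (V n)) (hV0 : μ (⋂ n, V n) = 0) {a b : ℝ} (ha : 0 ≤ a) (hb : 0 ≤ b)
    {c : ℝ} (hc : 1 ≤ c) {η : ℝ≥0∞} (hη : η ≠ 0) :
    ∃ N, ∀ n ≥ N, ∫⁻ ω in V n, ENNReal.ofReal
      (a * Real.log (c + lastVisit T (V n) ω) + b) ∂μ ≤ η := by
  have hη2 : 0 < η / 2 := ENNReal.half_pos hη
  -- First `s` is chosen so that Kac's inequality controls the linear term; the constant `K` is then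
  -- beaten by the small measure of `V n`.
  obtain ⟨s, hs, hs0⟩ : ∃ s : ℝ, ENNReal.ofReal (a * Real.exp (-s)) ≤ η / 2 ∧ 0 ≤ s := by
    have h1 : Tendsto (fun s : ℝ => ENNReal.ofReal (a * Real.exp (-s))) atTop (𝓝 0) := by
      have := ENNReal.tendsto_ofReal ((Real.tendsto_exp_neg_atTop_nhds_zero).const_mul a)
      simpa using this
    exact ((h1.eventually_le_const hη2).and (eventually_ge_atTop 0)).exists
  set K := a * (c * Real.exp (-s) + s) + b with hK
  have hK0 : 0 ≤ K := by positivity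
  have h1 : Tendsto (fun n => ENNReal.ofReal K * μ (V n)) atTop (𝓝 0) := by
    have := tendsto_measure_iInter_atTop (μ := μ) (fun n => (hVm n).nullMeasurableSet) hV
      ⟨0, measure_ne_top μ _⟩
    rw [hV0] at this
    simpa using ENNReal.Tendsto.const_mul this (Or.inr (ENNReal.ofReal_ne_top (r := K)))
  obtain ⟨N, hN⟩ := eventually_atTop.1 (h1.eventually_le_const hη2)
  refine ⟨N, fun n hn => ?_⟩
  have h2 : ∀ ω, ENNReal.ofReal (a * Real.log (c + lastVisit T (V n) ω) + b) ≤
      ENNReal.ofReal (a * Real.exp (-s)) * lastVisit T (V n) ω + ENNReal.ofReal K := by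
    intro ω
    rw [← ENNReal.ofReal_natCast, ← ENNReal.ofReal_mul (by positivity),
      ← ENNReal.ofReal_add (by positivity) hK0]
    refine ENNReal.ofReal_le_ofReal ?_
    have := mul_le_mul_of_nonneg_left (log_le_mul_exp_neg_add
      (y := c + lastVisit T (V n) ω) (by positivity) s) ha
    rw [hK]
    linarith
  calc _ ≤ ∫⁻ ω in V n, (ENNReal.ofReal (a * Real.exp (-s)) * lastVisit T (V n) ω +
        ENNReal.ofReal K) ∂μ := lintegral_mono h2
    _ = ENNReal.ofReal (a * Real.exp (-s)) * ∫⁻ ω in V n, lastVisit T (V n) ω ∂μ +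
        ENNReal.ofReal K * μ (V n) := by
      rw [lintegral_add_right _ measurable_const, lintegral_const_mul', setLIntegral_const]
      exact ENNReal.ofReal_ne_top
    _ ≤ η / 2 * 1 + η / 2 := add_le_add (mul_le_mul' hs (lintegral_lastVisit_le hT hT' (hVm n)))
      (hN n hn)
    _ = η := by rw [mul_one, ENNReal.add_halves]

/-- With `s` as the code length of an event of probability `p`, its entropy term exceeds the mean
cost `p * s` by at most `exp (-s)`, which can be made summable. -/
theorem negMulLog_le_mul_add_exp {p : ℝ} (hp : 0 ≤ p) (s : ℝ) :
    Real.negMulLog p ≤ p * s + Real.exp (-s) := by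
  rcases hp.eq_or_lt with rfl | hp
  · simpa using (Real.exp_pos _).le
  · have h1 := Real.log_le_sub_one_of_pos (div_pos (Real.exp_pos (-s)) hp)
    rw [Real.log_div (Real.exp_pos _).ne' hp.ne', Real.log_exp] at h1
    have h2 := mul_le_mul_of_nonneg_left h1 hp.le
    have h3 : p * (Real.exp (-s) / p - 1) = Real.exp (-s) - p := by
      field_simp
    rw [Real.negMulLog]
    linarith

/-- The entropy of an integer-valued function is bounded by the integral of its logarithm. -/
theorem entropy_le_lintegral_log [IsProbabilityMeasure μ] {f : Ω → ℕ} (hf : Measurable f) {t : ℝ}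
    (ht : 0 ≤ t) : entropy μ f ≤
      ∫⁻ ω in {ω | f ω ≠ 0}, ENNReal.ofReal (2 * Real.log (1 + f ω) + (t + 1)) ∂μ +
      ENNReal.ofReal (Real.exp (-t)) * ∑' a : ℕ, ENNReal.ofReal (1 / ((a : ℝ) + 1) ^ 2) := by
  have hm : MeasurableSet {ω | f ω ≠ 0} := hf (measurableSet_singleton 0).compl
  have hlog : ∀ a : ℕ, 0 ≤ Real.log (1 + a) := fun a => Real.log_nonneg (by simp)
  have h1 : ∀ a : ℕ, ENNReal.ofReal (Real.negMulLog (μ.real (f ⁻¹' {a}))) ≤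
      (if a = 0 then μ {ω | f ω ≠ 0} else 0) +
      (if a = 0 then 0 else ENNReal.ofReal (2 * Real.log (1 + a) + t)) * μ (f ⁻¹' {a}) +
      ENNReal.ofReal (Real.exp (-t)) * ENNReal.ofReal (1 / ((a : ℝ) + 1) ^ 2) := by
    intro a
    rcases eq_or_ne a 0 with rfl | ha
    -- The value `0` costs at most `1 - p`, the measure of the other values; this is the source of
    -- the `+ 1` in the integrand.
    · rw [if_pos rfl, if_pos rfl, zero_mul, add_zero]
      refine le_trans ?_ le_self_add
      have h2 : μ.real {ω | f ω ≠ 0} = 1 - μ.real (f ⁻¹' {0}) := by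
        rw [← probReal_compl_eq_one_sub (hf (measurableSet_singleton 0))]
        rfl
      rw [← ofReal_measureReal, h2]
      exact ENNReal.ofReal_le_ofReal (Real.negMulLog_le_one_sub_self measureReal_nonneg)
    · rw [if_neg ha, if_neg ha, zero_add, ← ofReal_measureReal (measure_ne_top μ _),
        ← ENNReal.ofReal_mul (by have := hlog a; positivity),
        ← ENNReal.ofReal_mul (Real.exp_pos _).le, ← ENNReal.ofReal_add
          (by have := hlog a; positivity) (by positivity)]
      refine ENNReal.ofReal_le_ofReal ?_
      -- Code length `2 * log (1 + a) + t`: the factor `2` gives a summable square, and `t` makes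
      -- the sum small.
      have h3 : Real.exp (-(2 * Real.log (1 + a) + t)) =
          Real.exp (-t) * (1 / ((a : ℝ) + 1) ^ 2) := by
        rw [neg_add, Real.exp_add, Real.exp_neg, mul_comm 2, Real.exp_mul, Real.exp_log
          (by positivity), add_comm (1 : ℝ)]
        norm_cast
        rw [one_div, mul_comm]
      rw [← h3, mul_comm _ (μ.real _)]
      exact negMulLog_le_mul_add_exp measureReal_nonneg _
  refine (ENNReal.tsum_le_tsum h1).trans ?_
  rw [ENNReal.tsum_add, ENNReal.tsum_add, ENNReal.tsum_mul_left, tsum_ite_eq]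
  refine add_le_add_left ?_ _
  have h4 : ∑' a : ℕ, (if a = 0 then 0 else ENNReal.ofReal (2 * Real.log (1 + a) + t)) *
      μ (f ⁻¹' {a}) = ∫⁻ ω in {ω | f ω ≠ 0}, ENNReal.ofReal (2 * Real.log (1 + f ω) + t) ∂μ := by
    have h5 := lintegral_map (μ := μ) (f := fun a : ℕ => if a = 0 then (0 : ℝ≥0∞) else
      ENNReal.ofReal (2 * Real.log (1 + a) + t)) (measurable_of_countable _) hf
    rw [lintegral_countable'] at h5
    rw [← lintegral_indicator hm]
    simp only [Measure.map_apply hf (measurableSet_singleton _)] at h5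
    rw [h5]
    refine lintegral_congr fun ω => ?_
    by_cases h : f ω = 0
    · simp [h]
    · rw [if_neg h, Set.indicator_of_mem (show ω ∈ {ω | f ω ≠ 0} from h)]
  rw [h4, ← one_mul (μ {ω | f ω ≠ 0}), ← setLIntegral_const, ← lintegral_add_left measurable_const]
  refine lintegral_mono fun ω => ?_
  rw [← ENNReal.ofReal_one, ← ENNReal.ofReal_add zero_le_one
    (by have := hlog (f ω); positivity)]
  exact ENNReal.ofReal_le_ofReal (by linarith)

end Markers

/-! ### Labels built from markers -/

section Construction

open Filter Topology

variable {Ω : Type*} {T : Equiv.Perm Ω} {B : ℕ → Set Ω}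

/-- The largest `i` with `ω ∈ B i`. -/
noncomputable def markerLevel (B : ℕ → Set Ω) (ω : Ω) : ℕ := sInf {i | ω ∉ B (i + 1)}

/-- The levels along the orbit of `ω`. -/
noncomputable def heights (T : Equiv.Perm Ω) (B : ℕ → Set Ω) (ω : Ω) (j : ℤ) : ℕ :=
  markerLevel B ((T ^ j) ω)

/-- No point of the orbit is in all markers, and every marker is visited often. -/
def IsMarked (T : Equiv.Perm Ω) (B : ℕ → Set Ω) (ω : Ω) : Prop :=
  (∀ k : ℤ, (T ^ k) ω ∉ ⋂ i, B i) ∧ ∀ i, VisitsOften T (B i) ω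

theorem le_markerLevel_iff (hB : Antitone B) (h0 : B 0 = Set.univ) {ω : Ω} (hω : ω ∉ ⋂ i, B i)
    {i : ℕ} : i ≤ markerLevel B ω ↔ ω ∈ B i := by
  have hne : {i | ω ∉ B (i + 1)}.Nonempty := by
    obtain ⟨j, hj⟩ := not_forall.1 fun h => hω (Set.mem_iInter.2 h)
    cases j with
    | zero => exact absurd (h0 ▸ Set.mem_univ ω) hj
    | succ j => exact ⟨j, hj⟩
  constructor
  · intro h
    cases i with
    | zero => exact h0 ▸ Set.mem_univ ω
    | succ i =>
      by_contra hc
      have := Nat.sInf_le (s := {i | ω ∉ B (i + 1)}) hc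
      unfold markerLevel at h
      omega
  · intro h
    by_contra! hc
    exact Nat.sInf_mem hne (hB (show markerLevel B ω + 1 ≤ i from hc) h)

theorem le_heights_iff (hB : Antitone B) (h0 : B 0 = Set.univ) {ω : Ω} (hω : IsMarked T B ω)
    {i : ℕ} {j : ℤ} : i ≤ heights T B ω j ↔ (T ^ j) ω ∈ B i :=
  le_markerLevel_iff hB h0 (hω.1 j)

theorem IsMarked.isRecurrent (hB : Antitone B) (h0 : B 0 = Set.univ) {ω : Ω}
    (hω : IsMarked T B ω) : IsRecurrent (heights T B ω) := by
  intro i j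
  simp only [le_heights_iff hB h0 hω]
  exact hω.2 i j

theorem heights_zpow (k : ℤ) (ω : Ω) :
    heights T B ((T ^ k) ω) = fun j => heights T B ω (j + k) := by
  ext j
  rw [heights, zpow_zpow_apply, heights]

theorem prevVisit_heights (hB : Antitone B) (h0 : B 0 = Set.univ) {ω : Ω}
    (hω : IsMarked T B ω) (i : ℕ) :
    prevVisit (heights T B ω) i 0 = lastVisit T (B i) ω := by
  simp only [prevVisit, lastVisit, le_heights_iff hB h0 hω, zero_sub]

/-- The code of the blocks at `ω`. -/
noncomputable def blockLabel (c : ℕ) (T : Equiv.Perm Ω) (B : ℕ → Set Ω) (q : ℕ → Ω → ℕ)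
    (ω : Ω) : ℕ :=
  blockCode c (heights T B ω) (fun i j => q i ((T ^ j) ω)) 0

/-- The code of the gaps before `ω`. -/
noncomputable def gapLabel (T : Equiv.Perm Ω) (B : ℕ → Set Ω) (ω : Ω) : ℕ :=
  gapCode (heights T B ω) 0

theorem blockLabel_zpow (c : ℕ) (q : ℕ → Ω → ℕ) (k : ℤ) (ω : Ω) :
    blockLabel c T B q ((T ^ k) ω) =
      blockCode c (heights T B ω) (fun i j => q i ((T ^ j) ω)) k := by
  simp only [blockLabel, heights_zpow, zpow_zpow_apply]
  rw [blockCode_shift (x := heights T B ω) (q := fun i j => q i ((T ^ j) ω)), zero_add]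

theorem gapLabel_zpow (k : ℤ) (ω : Ω) :
    gapLabel T B ((T ^ k) ω) = gapCode (heights T B ω) k := by
  rw [gapLabel, heights_zpow, gapCode_shift, zero_add]

section Measurable

variable [MeasurableSpace Ω] {μ : Measure Ω}

theorem measurable_comp_nat {F : ℕ → Ω → ℕ} (hF : ∀ n, Measurable (F n)) {N : Ω → ℕ}
    (hN : Measurable N) : Measurable fun ω => F (N ω) ω := by
  refine measurable_to_countable' fun x => ?_
  have : (fun ω => F (N ω) ω) ⁻¹' {x} = ⋃ n, N ⁻¹' {n} ∩ F n ⁻¹' {x} := by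
    ext ω
    simp
  rw [this]
  exact MeasurableSet.iUnion fun n =>
    (hN (measurableSet_singleton n)).inter (hF n (measurableSet_singleton x))

theorem Measurable.natPair {f g : Ω → ℕ} (hf : Measurable f) (hg : Measurable g) :
    Measurable fun ω => Nat.pair (f ω) (g ω) :=
  (measurable_of_countable fun p : ℕ × ℕ => Nat.pair p.1 p.2).comp (hf.prodMk hg)

theorem measurable_wordCode {u : ℕ → Ω → ℕ} (hu : ∀ j, Measurable (u j)) (n : ℕ) :
    Measurable fun ω => wordCode (fun j => u j ω) n := by
  induction n with
  | zero => exact measurable_const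
  | succ n ih => exact Measurable.natPair ih (hu n)

section Sequences

variable {x : Ω → ℤ → ℕ} (hx : ∀ j, Measurable fun ω => x ω j)
include hx

theorem measurable_prevVisit {i : Ω → ℕ} (hi : Measurable i) (j : ℤ) :
    Measurable fun ω => prevVisit (x ω) (i ω) j :=
  measurable_comp_nat (F := fun n ω => prevVisit (x ω) n j)
    (fun _ => measurable_sInf_nat fun _ => (MeasurableSet.const _).inter
      (measurableSet_le measurable_const (hx _))) hi

theorem measurable_nextVisit {i : Ω → ℕ} (hi : Measurable i) (j : ℤ) :
    Measurable fun ω => nextVisit (x ω) (i ω) j :=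
  measurable_comp_nat (F := fun n ω => nextVisit (x ω) n j)
    (fun _ => measurable_sInf_nat fun _ => (MeasurableSet.const _).inter
      (measurableSet_le measurable_const (hx _))) hi

theorem measurable_lastHigher (j : ℤ) : Measurable fun ω => lastHigher (x ω) j :=
  measurable_prevVisit hx ((hx j).add_const 1) j

theorem measurable_nextHigher (j : ℤ) : Measurable fun ω => nextHigher (x ω) j :=
  measurable_nextVisit hx ((hx j).add_const 1) j

theorem measurable_gapCode (j : ℤ) : Measurable fun ω => gapCode (x ω) j :=
  Measurable.natPair (hx j) (measurable_comp_nat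
    (F := fun n ω => wordCode (fun i => prevVisit (x ω) (i + 1) j) n)
    (fun n => measurable_wordCode (fun _ => measurable_prevVisit hx measurable_const j) n) (hx j))

theorem measurable_blockCode (c : ℕ) {q : Ω → ℕ → ℤ → ℕ} (hq : ∀ i j, Measurable fun ω => q ω i j)
    (j : ℤ) : Measurable fun ω => blockCode c (x ω) (q ω) j := by
  have hp := (measurable_prevVisit hx (hx j) j).const_mul c
  have hn := measurable_nextVisit hx (hx j) j
  refine Measurable.add_const (Measurable.natPair
    ((measurable_lastHigher hx _).add ((measurable_nextHigher hx _).const_mul c))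
    (Measurable.natPair (hx j) (Measurable.natPair hp (Measurable.natPair hn ?_)))) 1
  refine measurable_comp_nat (F := fun a ω => wordCode (fun s => Nat.pair (x ω (j - (a : ℕ) + s))
    (Nat.pair (lastHigher (x ω) (j - (a : ℕ) + s)) (Nat.pair (nextHigher (x ω) (j - (a : ℕ) + s))
    (wordCode (fun i => q ω i (j - (a : ℕ) + s)) (x ω j + 1)))))
    (a + nextVisit (x ω) (x ω j) j + 1)) (fun a => ?_) hp
  refine measurable_comp_nat (F := fun n ω => wordCode (fun s => Nat.pair (x ω (j - (a : ℕ) + s))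
    (Nat.pair (lastHigher (x ω) (j - (a : ℕ) + s)) (Nat.pair (nextHigher (x ω) (j - (a : ℕ) + s))
    (wordCode (fun i => q ω i (j - (a : ℕ) + s)) (x ω j + 1))))) n) (fun n => ?_)
    ((hn.const_add a).add_const 1)
  refine measurable_wordCode (fun s => Measurable.natPair (hx _) (Measurable.natPair
    (measurable_lastHigher hx _) (Measurable.natPair (measurable_nextHigher hx _) ?_))) n
  exact measurable_comp_nat (F := fun n ω => wordCode (fun i => q ω i (j - (a : ℕ) + s)) n)
    (fun n => measurable_wordCode (fun i => hq i _) n) ((hx j).add_const 1)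

end Sequences

theorem measurable_heights (hT : MeasurePreserving T μ μ) (hT' : MeasurePreserving ⇑T⁻¹ μ μ)
    (hB : ∀ i, MeasurableSet (B i)) (j : ℤ) : Measurable fun ω => heights T B ω j :=
  (measurable_sInf_nat fun i => (hB (i + 1)).compl).comp
    (measurePreserving_zpow hT hT' j).measurable

theorem measurable_gapLabel (hT : MeasurePreserving T μ μ) (hT' : MeasurePreserving ⇑T⁻¹ μ μ)
    (hB : ∀ i, MeasurableSet (B i)) : Measurable (gapLabel T B) :=
  measurable_gapCode (measurable_heights hT hT' hB) 0

theorem measurable_blockLabel (hT : MeasurePreserving T μ μ) (hT' : MeasurePreserving ⇑T⁻¹ μ μ)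
    (hB : ∀ i, MeasurableSet (B i)) (c : ℕ) {q : ℕ → Ω → ℕ} (hq : ∀ i, Measurable (q i)) :
    Measurable (blockLabel c T B q) :=
  measurable_blockCode (measurable_heights hT hT' hB) c
    (fun i j => (hq i).comp (measurePreserving_zpow hT hT' j).measurable) 0

end Measurable

/-- The markers and the labels `P` up to some place in the future determine the block. -/
theorem blockLabel_eq_of_gapLabel_eq (hB : Antitone B) (h0 : B 0 = Set.univ) {P : Ω → ℕ}
    {ω₁ ω₂ : Ω} (h1 : IsMarked T B ω₁) (h2 : IsMarked T B ω₂)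
    (h : ∀ k < lookAhead (heights T B ω₁) 0, P ((T ^ k) ω₁) = P ((T ^ k) ω₂) ∧
      gapLabel T B ((T ^ k) ω₁) = gapLabel T B ((T ^ k) ω₂)) :
    blockLabel 0 T B (fun _ => P) ω₁ = blockLabel 0 T B (fun _ => P) ω₂ := by
  have h' : ∀ t : ℤ, 0 ≤ t → t < 0 + lookAhead (heights T B ω₁) 0 →
      P ((T ^ t) ω₁) = P ((T ^ t) ω₂) ∧
      gapLabel T B ((T ^ t) ω₁) = gapLabel T B ((T ^ t) ω₂) := by
    intro t ht ht'
    lift t to ℕ using ht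
    simpa only [zpow_natCast] using h t (by omega)
  refine blockCode_eq_of_gapCode_eq (h1.isRecurrent hB h0) (h2.isRecurrent hB h0)
    (fun t ht ht' => ?_) fun t ht ht' i => (h' t ht ht').1
  simpa only [gapLabel_zpow] using (h' t ht ht').2

/-- Gaps at lower levels are no longer than the gap at the level of `j` itself, so one return time
bounds every letter; the pairings cost the exponent. -/
theorem log_gapCode_le {x : ℤ → ℕ} (hx : IsRecurrent x) (j : ℤ) :
    Real.log (1 + gapCode x j) ≤
      2 ^ (x j + 1) * Real.log (1 + x j + prevVisit x (x j) j) := by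
  have h1 : ∀ i < x j, prevVisit x (i + 1) j ≤ x j + prevVisit x (x j) j := fun i hi =>
    (prevVisit_le (hx.prevVisit_spec (x j) j).1
      ((show i + 1 ≤ x j from hi).trans (hx.prevVisit_spec (x j) j).2)).trans (by omega)
  have h2 := wordCode_succ_le h1
  have h3 : x j + prevVisit x (x j) j + 1 ≤ (x j + prevVisit x (x j) j + 1) ^ 2 ^ x j :=
    Nat.le_self_pow (by positivity) _
  have h4 := pair_succ_le (M := (x j + prevVisit x (x j) j + 1) ^ 2 ^ x j - 1) (a := x j)
    (b := wordCode (fun i => prevVisit x (i + 1) j) (x j)) (by omega) (by omega)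
  rw [Nat.sub_add_cancel (by omega), ← pow_mul, ← pow_succ] at h4
  have h5 : (1 + gapCode x j : ℝ) ≤ (1 + x j + prevVisit x (x j) j) ^ 2 ^ (x j + 1) := by
    have : ((gapCode x j + 1 : ℕ) : ℝ) ≤ ((x j + prevVisit x (x j) j + 1) ^ 2 ^ (x j + 1) : ℕ) :=
      Nat.cast_le.2 h4
    push_cast at this
    rw [add_comm (1 : ℝ) (gapCode x j), add_assoc, add_comm (1 : ℝ)]
    exact this
  refine (Real.log_le_log (by positivity) h5).trans_eq ?_
  rw [Real.log_pow]
  push_cast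
  rfl

theorem height_ne_zero_of_gapCode_ne_zero {x : ℤ → ℕ} {j : ℤ} (h : gapCode x j ≠ 0) : x j ≠ 0 := by
  intro h0
  refine h ?_
  rw [gapCode, h0]
  rfl

variable [MeasurableSpace Ω] {μ : Measure Ω}

theorem isLookbackGenerator_blockLabel (hT : MeasurePreserving T μ μ)
    (hT' : MeasurePreserving ⇑T⁻¹ μ μ) (hB : Antitone B) (h0 : B 0 = Set.univ)
    (hBm : ∀ i, MeasurableSet (B i)) (hmark : ∀ᵐ ω ∂μ, IsMarked T B ω) {c : ℕ}
    (hc : c = 0 ∨ c = 1) {q : ℕ → Ω → ℕ} (hq : ∀ i, Measurable (q i)) {Z : Set Ω} (hZ : μ Z = 0)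
    (hgen : ∀ ω₁ ∉ Z, ∀ ω₂ ∉ Z,
      (∀ i (k : ℤ), q i ((T ^ k) ω₁) = q i ((T ^ k) ω₂)) → ω₁ = ω₂) :
    IsLookbackGenerator T μ (blockLabel c T B q) where
  measurable := measurable_blockLabel hT hT' hBm c hq
  one_le ω := Nat.succ_le_succ (Nat.zero_le _)
  generates := by
    refine ⟨Z ∪ {ω | ¬IsMarked T B ω}, measure_union_null hZ hmark, fun ω₁ h1 ω₂ h2 h => ?_⟩
    simp only [Set.mem_union, Set.mem_ofPred_eq, not_or, not_not] at h1 h2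
    refine hgen ω₁ h1.1 ω₂ h2.1 fun i k => ?_
    refine data_eq_of_blockCode_eq (c := c) (x₂ := heights T B ω₂)
      (q₁ := fun i j => q i ((T ^ j) ω₁))
      (q₂ := fun i j => q i ((T ^ j) ω₂)) (h1.2.isRecurrent hB h0) (fun k => ?_) i
    simpa only [blockLabel_zpow] using h k
  determines := by
    refine ⟨{ω | ¬IsMarked T B ω}, hmark, fun ω₁ h1 ω₂ h2 n hn _ h => ?_⟩
    simp only [Set.mem_ofPred_eq, not_not] at h1
    rw [← zpow_neg_one, blockLabel_zpow] at hn
    refine blockCode_eq_of_past (h1.isRecurrent hB h0) hc (j := 0) hn fun k hk hkn => ?_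
    simpa only [blockLabel_zpow, zero_sub] using h k hk hkn

theorem isLookbackGenerator_inv_blockLabel (hT : MeasurePreserving T μ μ)
    (hT' : MeasurePreserving ⇑T⁻¹ μ μ) (hB : Antitone B) (h0 : B 0 = Set.univ)
    (hBm : ∀ i, MeasurableSet (B i)) (hmark : ∀ᵐ ω ∂μ, IsMarked T B ω)
    {q : ℕ → Ω → ℕ} (hq : ∀ i, Measurable (q i)) {Z : Set Ω} (hZ : μ Z = 0)
    (hgen : ∀ ω₁ ∉ Z, ∀ ω₂ ∉ Z,
      (∀ i (k : ℤ), q i ((T ^ k) ω₁) = q i ((T ^ k) ω₂)) → ω₁ = ω₂) :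
    IsLookbackGenerator T⁻¹ μ (blockLabel 1 T B q) where
  measurable := measurable_blockLabel hT hT' hBm 1 hq
  one_le ω := Nat.succ_le_succ (Nat.zero_le _)
  generates := by
    obtain ⟨Z', hZ', h⟩ := (isLookbackGenerator_blockLabel hT hT' hB h0 hBm hmark (Or.inr rfl)
      hq hZ hgen).generates
    refine ⟨Z', hZ', fun ω₁ h1 ω₂ h2 h' => h ω₁ h1 ω₂ h2 fun k => ?_⟩
    simpa using h' (-k)
  determines := by
    refine ⟨{ω | ¬IsMarked T B ω}, hmark, fun ω₁ h1 ω₂ h2 n hn _ h => ?_⟩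
    simp only [Set.mem_ofPred_eq, not_not] at h1
    rw [inv_inv, show T ω₁ = (T ^ (1 : ℤ)) ω₁ by simp, blockLabel_zpow] at hn
    refine blockCode_eq_of_future (h1.isRecurrent hB h0) (j := 0) hn fun k hk hkn => ?_
    have := h k hk hkn
    rw [zpow_neg, inv_zpow, inv_inv] at this
    simpa only [blockLabel_zpow, zero_add] using this

variable [IsProbabilityMeasure μ]

/-- Markers that are so rare that the gaps between them have small entropy. -/
theorem exists_markers (hT : MeasurePreserving T μ μ)
    (hT' : MeasurePreserving ⇑T⁻¹ μ μ) (hper : IsNonperiodic T μ) {φ : Ω → ℝ} (hφ : Measurable φ)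
    {Z : Set Ω} (hZ : μ Z = 0) (hinj : Set.InjOn φ Zᶜ) {ε : ℝ≥0∞} (hε : ε ≠ 0) :
    ∃ B : ℕ → Set Ω, Antitone B ∧ B 0 = Set.univ ∧ (∀ i, MeasurableSet (B i)) ∧
      (∀ᵐ ω ∂μ, IsMarked T B ω) ∧ entropy μ (gapLabel T B) < ε := by
  obtain ⟨V, hV, hVm, hV0, hVvis⟩ := exists_vanishing_markers hT hT' hper hφ hZ hinj
  have hε2 : 0 < ε / 2 := ENNReal.half_pos hε
  set C : ℝ≥0∞ := ∑' a : ℕ, ENNReal.ofReal (1 / ((a : ℝ) + 1) ^ 2) with hC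
  have hCfin : C ≠ ∞ := by
    have h1 : Summable fun a : ℕ => 1 / ((a : ℝ) + 1) ^ 2 := by
      have := (summable_nat_add_iff 1).2 (Real.summable_one_div_nat_pow.2 one_lt_two)
      exact_mod_cast this
    exact h1.tsum_ofReal_ne_top
  obtain ⟨t, ht, ht0⟩ : ∃ t : ℝ, ENNReal.ofReal (Real.exp (-t)) * C < ε / 2 ∧ 0 ≤ t := by
    have h1 : Tendsto (fun s : ℝ => ENNReal.ofReal (Real.exp (-s)) * C) atTop (𝓝 0) := by
      have := ENNReal.Tendsto.mul_const (ENNReal.tendsto_ofReal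
        Real.tendsto_exp_neg_atTop_nhds_zero) (Or.inr hCfin)
      simpa using this
    exact ((h1.eventually_lt_const hε2).and (eventually_ge_atTop 0)).exists
  obtain ⟨η, hη0, hη⟩ := ENNReal.exists_pos_sum_of_countable' hε2.ne' ℕ
  -- The constants for height `i + 1` are fixed before the marker is chosen: `2 ^ (i + 2)` comes
  -- from `log_gapCode_le`, the extra factor `2` from the entropy bound.
  have hN := fun i : ℕ => exists_lintegral_log_lastVisit_le hT hT' hV hVm hV0
    (a := 2 * 2 ^ (i + 2)) (b := t + 1) (by positivity) (by positivity) (c := 1 + (i + 1 : ℕ))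
    (by push_cast; linarith [(Nat.cast_nonneg i : (0 : ℝ) ≤ i)]) (hη0 i).ne'
  choose N hN using hN
  -- Partial sums make `n` monotone, at least `N i`, and at least `i`, so the chosen markers still
  -- decrease to a null set.
  set n : ℕ → ℕ := fun i => ∑ k ∈ Finset.range (i + 1), (N k + 1) with hn
  have hnN : ∀ i, N i ≤ n i := fun i => by
    rw [hn]
    simp only [Finset.sum_range_succ]
    omega
  have hni : ∀ i, i ≤ n i := fun i => by
    have := Finset.card_nsmul_le_sum (Finset.range (i + 1)) (fun k => N k + 1) 1 (by simp)
    simp only [Finset.card_range, smul_eq_mul, mul_one] at this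
    simp only [hn]
    omega
  have hnmono : Monotone n := fun i j hij =>
    Finset.sum_le_sum_of_subset (Finset.range_mono (by omega))
  set B : ℕ → Set Ω := fun i => i.casesOn Set.univ fun k => V (n k) with hBdef
  have hB : Antitone B := by
    refine antitone_nat_of_succ_le fun i => ?_
    cases i with
    | zero => exact Set.subset_univ _
    | succ i => exact hV (hnmono i.le_succ)
  have hBm : ∀ i, MeasurableSet (B i) := fun i => by
    cases i with
    | zero => exact MeasurableSet.univ
    | succ i => exact hVm _
  have hBV : ⋂ i, B i ⊆ ⋂ i, V i := fun ω hω =>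
    Set.mem_iInter.2 fun i => hV (hni i) (Set.mem_iInter.1 hω (i + 1))
  have hnull : ∀ᵐ ω ∂μ, ω ∉ ⋂ i, B i :=
    measure_eq_zero_iff_ae_notMem.1 (measure_mono_null hBV hV0)
  have hmark : ∀ᵐ ω ∂μ, IsMarked T B ω := by
    filter_upwards [ae_orbit hT hT' hnull, hVvis] with ω h1 h2
    refine ⟨h1, fun i => ?_⟩
    cases i with
    | zero => exact fun j => ⟨⟨1, le_rfl, Set.mem_univ _⟩, 1, le_rfl, Set.mem_univ _⟩
    | succ i => exact h2 (n i)
  refine ⟨B, hB, rfl, hBm, hmark, ?_⟩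
  have hf := measurable_gapLabel hT hT' hBm
  refine (entropy_le_lintegral_log hf ht0).trans_lt ?_
  rw [← ENNReal.add_halves ε]
  refine ENNReal.add_lt_add (lt_of_le_of_lt ?_ hη) ht
  have hrm : ∀ i, Measurable fun ω => ENNReal.ofReal (2 * 2 ^ (i + 2) *
      Real.log (1 + (i + 1 : ℕ) + lastVisit T (V (n i)) ω) + (t + 1)) := fun i =>
    (measurable_of_countable fun r : ℕ => ENNReal.ofReal (2 * 2 ^ (i + 2) *
      Real.log (1 + (i + 1 : ℕ) + r) + (t + 1))).comp (measurable_lastVisit hT hT' (hVm _))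
  calc ∫⁻ ω in {ω | gapLabel T B ω ≠ 0}, ENNReal.ofReal
        (2 * Real.log (1 + gapLabel T B ω) + (t + 1)) ∂μ
      ≤ ∫⁻ ω, ∑' i, (V (n i)).indicator (fun ω => ENNReal.ofReal (2 * 2 ^ (i + 2) *
        Real.log (1 + (i + 1 : ℕ) + lastVisit T (V (n i)) ω) + (t + 1))) ω ∂μ := by
        rw [← lintegral_indicator (s := {ω | gapLabel T B ω ≠ 0})
          (hf (measurableSet_singleton 0)).compl]
        refine lintegral_mono_ae ?_
        filter_upwards [hmark] with ω hω
        by_cases h0 : gapLabel T B ω = 0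
        · rw [Set.indicator_of_notMem (s := {ω | gapLabel T B ω ≠ 0}) (fun h => h h0)]
          exact zero_le
        · rw [Set.indicator_of_mem (s := {ω | gapLabel T B ω ≠ 0}) h0]
          -- A nonzero gap label forces height `l + 1`, and the term of index `l` alone dominates
          -- the integrand.
          obtain ⟨l, hl⟩ := Nat.exists_eq_succ_of_ne_zero (height_ne_zero_of_gapCode_ne_zero h0)
          have hmem : ω ∈ V (n l) := by
            have := (le_heights_iff hB rfl hω).1 hl.ge
            simpa using this
          refine le_trans ?_ (ENNReal.le_tsum l)
          rw [Set.indicator_of_mem hmem]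
          refine ENNReal.ofReal_le_ofReal ?_
          have h1 := log_gapCode_le (hω.isRecurrent hB rfl) 0
          rw [prevVisit_heights hB rfl hω, hl] at h1
          have h2 : lastVisit T (B l.succ) ω = lastVisit T (V (n l)) ω := rfl
          rw [h2] at h1
          have h3 : gapLabel T B ω = gapCode (heights T B ω) 0 := rfl
          rw [h3]
          have h4 : (2 : ℝ) ^ (l.succ + 1) = 2 ^ (l + 2) := rfl
          rw [h4] at h1
          have h5 : ((l.succ : ℕ) : ℝ) = ((l + 1 : ℕ) : ℝ) := rfl
          rw [h5] at h1
          linarith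
    _ = ∑' i, ∫⁻ ω in V (n i), ENNReal.ofReal (2 * 2 ^ (i + 2) *
        Real.log (1 + (i + 1 : ℕ) + lastVisit T (V (n i)) ω) + (t + 1)) ∂μ := by
        rw [lintegral_tsum fun i => ((hrm i).indicator (hVm _)).aemeasurable]
        exact tsum_congr fun i => lintegral_indicator (hVm _) _
    _ ≤ ∑' i, η i := ENNReal.tsum_le_tsum fun i => hN i (n i) (hnN i)

theorem exists_two_sided_generator (hT : MeasurePreserving T μ μ)
    (hT' : MeasurePreserving ⇑T⁻¹ μ μ) (hper : IsNonperiodic T μ) {φ : Ω → ℝ} (hφ : Measurable φ)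
    {Z : Set Ω} (hZ : μ Z = 0) (hinj : Set.InjOn φ Zᶜ) :
    ∃ h : Ω → ℕ, IsLookbackGenerator T μ h ∧ IsLookbackGenerator T⁻¹ μ h := by
  obtain ⟨B, hB, h0, hBm, hmark, -⟩ := exists_markers hT hT' hper hφ hZ hinj one_ne_zero
  -- Integer approximations that together determine `φ`. A block of height `i` records only finitely
  -- many of them; the exponential avoids truncation of negative values by `⌊·⌋₊`.
  set q : ℕ → Ω → ℕ := fun i ω => ⌊(i : ℝ) * Real.exp (φ ω)⌋₊ with hq
  have hqm : ∀ i, Measurable (q i) := fun i =>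
    Nat.measurable_floor.comp ((Real.measurable_exp.comp hφ).const_mul _)
  have hgen : ∀ ω₁ ∉ Z, ∀ ω₂ ∉ Z,
      (∀ i (k : ℤ), q i ((T ^ k) ω₁) = q i ((T ^ k) ω₂)) → ω₁ = ω₂ := by
    have key : ∀ ω₁ ω₂, (∀ i, q i ω₁ = q i ω₂) → Real.exp (φ ω₁) ≤ Real.exp (φ ω₂) := by
      intro ω₁ ω₂ h
      refine le_of_forall_pos_lt_add fun ε hε => ?_
      obtain ⟨n, hn⟩ := exists_nat_one_div_lt hε
      have h1 := Nat.floor_le (a := ((n + 1 : ℕ) : ℝ) * Real.exp (φ ω₂)) (by positivity)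
      have h2 := Nat.lt_floor_add_one (((n + 1 : ℕ) : ℝ) * Real.exp (φ ω₁))
      have h3 : ⌊((n + 1 : ℕ) : ℝ) * Real.exp (φ ω₁)⌋₊ = ⌊((n + 1 : ℕ) : ℝ) * Real.exp (φ ω₂)⌋₊ :=
        h (n + 1)
      rw [h3] at h2
      have hn0 : (0 : ℝ) < (n : ℝ) + 1 := by positivity
      rw [div_lt_iff₀ hn0] at hn
      push_cast at h1 h2
      refine lt_of_mul_lt_mul_left ?_ hn0.le
      linarith
    intro ω₁ h1 ω₂ h2 h
    refine hinj h1 h2 (Real.exp_injective (le_antisymm (key _ _ fun i => ?_)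
      (key _ _ fun i => ?_)))
    · simpa using h i 0
    · simpa using (h i 0).symm
  exact ⟨_, isLookbackGenerator_blockLabel hT hT' hB h0 hBm hmark (Or.inr rfl) hqm hZ hgen,
    isLookbackGenerator_inv_blockLabel hT hT' hB h0 hBm hmark hqm hZ hgen⟩

theorem exists_one_sided_generator (hT : MeasurePreserving T μ μ)
    (hT' : MeasurePreserving ⇑T⁻¹ μ μ) (hper : IsNonperiodic T μ) {φ : Ω → ℝ} (hφ : Measurable φ)
    {Z : Set Ω} (hZ : μ Z = 0) (hinj : Set.InjOn φ Zᶜ) {P : Ω → ℕ} (hP : Measurable P)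
    (hgen : Generates T μ P) {ε : ℝ≥0∞} (hε : ε ≠ 0) :
    ∃ h f : Ω → ℕ, IsLookbackGenerator T μ h ∧ Determines μ h P ∧ Measurable f ∧
      entropy μ f < ε ∧ ∃ Z, μ Z = 0 ∧ ∀ ω₁ ∉ Z, ∃ N : ℕ, ∀ ω₂ ∉ Z,
        (∀ k < N, P ((T ^ k) ω₁) = P ((T ^ k) ω₂) ∧ f ((T ^ k) ω₁) = f ((T ^ k) ω₂)) →
        h ω₁ = h ω₂ := by
  obtain ⟨B, hB, h0, hBm, hmark, hent⟩ := exists_markers hT hT' hper hφ hZ hinj hε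
  obtain ⟨Y, hY, hgen⟩ := hgen
  refine ⟨blockLabel 0 T B fun _ => P, gapLabel T B,
    isLookbackGenerator_blockLabel hT hT' hB h0 hBm hmark (Or.inl rfl) (fun _ => hP) hY
      fun ω₁ h1 ω₂ h2 h => hgen ω₁ h1 ω₂ h2 fun k => h 0 k,
    ⟨∅, measure_empty, fun ω₁ _ ω₂ _ h => ?_⟩, measurable_gapLabel hT hT' hBm, hent,
    {ω | ¬IsMarked T B ω}, hmark,
    fun ω₁ h1 => ⟨lookAhead (heights T B ω₁) 0, fun ω₂ h2 => ?_⟩⟩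
  · simpa using data_zero_eq_of_blockCode_eq h
  · exact blockLabel_eq_of_gapLabel_eq hB h0 (not_not.1 h1) (not_not.1 h2)

end Construction

/-! ### Passage to and from the completion -/

section Transfer

variable {Ω : Type*} [MeasurableSpace Ω] {μ : Measure Ω} {T : Equiv.Perm Ω} {h h' : Ω → ℕ}

theorem IsLebesgueSpace.ae_orbit (hμ : IsLebesgueSpace μ) (hT : MeasurePreserving T μ μ)
    {p : Ω → Prop} (hp : ∀ᵐ ω ∂μ, p ω) : ∀ᵐ ω ∂μ, ∀ k : ℤ, p ((T ^ k) ω) :=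
  Kalikow.ae_orbit (Ω := NullMeasurableSpace Ω μ) (μ := μ.completion)
    (hμ.measurePreserving_completion hT).1 (hμ.measurePreserving_completion hT).2 hp

theorem Generates.congr (hh : ∀ᵐ ω ∂μ, ∀ k : ℤ, h ((T ^ k) ω) = h' ((T ^ k) ω))
    (hgen : Generates T μ h) : Generates T μ h' := by
  obtain ⟨Z, hZ, H⟩ := hgen
  refine ⟨Z ∪ {ω | ¬∀ k : ℤ, h ((T ^ k) ω) = h' ((T ^ k) ω)}, measure_union_null hZ hh,
    fun ω₁ h1 ω₂ h2 h => ?_⟩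
  simp only [Set.mem_union, Set.mem_ofPred_eq, not_or, not_not] at h1 h2
  exact H ω₁ h1.1 ω₂ h2.1 fun k => by rw [h1.2, h2.2, h]

theorem RecentPastDetermines.congr (hh : ∀ᵐ ω ∂μ, ∀ k : ℤ, h ((T ^ k) ω) = h' ((T ^ k) ω))
    (hdet : RecentPastDetermines T μ h) : RecentPastDetermines T μ h' := by
  obtain ⟨Z, hZ, H⟩ := hdet
  refine ⟨Z ∪ {ω | ¬∀ k : ℤ, h ((T ^ k) ω) = h' ((T ^ k) ω)}, measure_union_null hZ hh,
    fun ω₁ h1 ω₂ h2 n hn1 hn2 h => ?_⟩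
  simp only [Set.mem_union, Set.mem_ofPred_eq, not_or, not_not] at h1 h2
  rw [← zpow_neg_one] at hn1 hn2
  have := H ω₁ h1.1 ω₂ h2.1 n (by rw [← zpow_neg_one, h1.2, hn1])
    (by rw [← zpow_neg_one, h2.2, hn2]) fun k hk hkn => by rw [h1.2, h2.2, h k hk hkn]
  have e₁ := h1.2 0
  have e₂ := h2.2 0
  simp only [zpow_zero, Equiv.Perm.coe_one, id_eq] at e₁ e₂
  rw [← e₁, ← e₂, this]

theorem exists_measurable_ae_eq (hm : NullMeasurable h μ) :
    ∃ h' : Ω → ℕ, Measurable h' ∧ ∀ᵐ ω ∂μ, h ω = h' ω :=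
  hm.aemeasurable

theorem exists_measurable_pos_ae_eq (hm : NullMeasurable h μ) (h1 : ∀ ω, 1 ≤ h ω) :
    ∃ h' : Ω → ℕ, Measurable h' ∧ (∀ ω, 1 ≤ h' ω) ∧ ∀ᵐ ω ∂μ, h ω = h' ω := by
  obtain ⟨h', hm', he⟩ := exists_measurable_ae_eq hm
  refine ⟨fun ω => max (h' ω) 1, hm'.max measurable_const, fun ω => le_max_right _ _, ?_⟩
  filter_upwards [he] with ω hω
  rw [← hω, max_eq_left (h1 ω)]

theorem IsLebesgueSpace.exists_injOn (hμ : IsLebesgueSpace μ) :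
    ∃ (φ : Ω → ℝ) (Z : Set Ω), Measurable φ ∧ μ Z = 0 ∧ Set.InjOn φ Zᶜ := by
  obtain ⟨ν, φ, ψ, hφ, -, h1, -⟩ := hμ.exists_iso
  refine ⟨φ, {ω | ψ (φ ω) ≠ ω}, hφ.measurable, h1, fun ω₁ h1 ω₂ h2 h => ?_⟩
  rw [← not_not.1 h1, ← not_not.1 h2, h]

theorem IsLebesgueSpace.exists_two_sided_generator (hμ : IsLebesgueSpace μ)
    (hT : MeasurePreserving T μ μ) (hper : IsNonperiodic T μ) :
    ∃ h : Ω → ℕ, NullMeasurable h μ ∧ (∀ ω, 1 ≤ h ω) ∧ Generates T μ h ∧ Generates T⁻¹ μ h ∧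
      RecentPastDetermines T μ h ∧ RecentPastDetermines T⁻¹ μ h := by
  have := hμ.isProbabilityMeasure
  have : IsProbabilityMeasure μ.completion := ⟨measure_univ (μ := μ)⟩
  obtain ⟨φ, Z, hφ, hZ, hinj⟩ := hμ.exists_injOn
  obtain ⟨hTc, hTc'⟩ := hμ.measurePreserving_completion hT
  obtain ⟨h, h1, h2⟩ := Kalikow.exists_two_sided_generator (Ω := NullMeasurableSpace Ω μ)
    (μ := μ.completion) hTc hTc' hper (φ := φ) (fun s hs => (hφ hs).nullMeasurableSet) hZ hinj
  exact ⟨h, h1.measurable, h1.one_le, h1.generates, h2.generates, h1.determines, h2.determines⟩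

theorem IsLebesgueSpace.exists_one_sided_generator (hμ : IsLebesgueSpace μ)
    (hT : MeasurePreserving T μ μ) (hper : IsNonperiodic T μ) {P : Ω → ℕ} (hP : Measurable P)
    (hgen : Generates T μ P) {ε : ℝ≥0∞} (hε : ε ≠ 0) :
    ∃ h f : Ω → ℕ, NullMeasurable h μ ∧ (∀ ω, 1 ≤ h ω) ∧ Generates T μ h ∧
      RecentPastDetermines T μ h ∧ Determines μ h P ∧ NullMeasurable f μ ∧ entropy μ f < ε ∧
      ∃ Z, μ Z = 0 ∧ ∀ ω₁ ∉ Z, ∃ N : ℕ, ∀ ω₂ ∉ Z,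
        (∀ k < N, P ((T ^ k) ω₁) = P ((T ^ k) ω₂) ∧ f ((T ^ k) ω₁) = f ((T ^ k) ω₂)) →
        h ω₁ = h ω₂ := by
  have := hμ.isProbabilityMeasure
  have : IsProbabilityMeasure μ.completion := ⟨measure_univ (μ := μ)⟩
  obtain ⟨φ, Z, hφ, hZ, hinj⟩ := hμ.exists_injOn
  obtain ⟨hTc, hTc'⟩ := hμ.measurePreserving_completion hT
  obtain ⟨h, f, h1, h2, h3, h4, h5⟩ := Kalikow.exists_one_sided_generator
    (Ω := NullMeasurableSpace Ω μ) (μ := μ.completion) hTc hTc' hper (φ := φ)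
    (fun s hs => (hφ hs).nullMeasurableSet) hZ hinj (P := P)
    (fun s hs => (hP hs).nullMeasurableSet) hgen hε
  exact ⟨h, f, h1.measurable, h1.one_le, h1.generates, h1.determines, h2, h3, h4, h5⟩

end Transfer

end Kalikow

theorem theorem1p1 {Ω : Type*} [MeasurableSpace Ω] (μ : Measure Ω)
    (hμ : Kalikow.IsLebesgueSpace μ) (T : Equiv.Perm Ω) (hT : MeasurePreserving T μ μ)
    (hper : Kalikow.IsNonperiodic T μ) :
    -- the generator exists
    (∃ h : Ω → ℕ, Kalikow.IsLookbackGenerator T μ h) ∧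
    -- it can be chosen so that the future says almost nothing about the past
    (∀ P : Ω → ℕ, Measurable P → Kalikow.Generates T μ P → ∀ ε : ℝ, 0 < ε →
      ∃ h : Ω → ℕ, Kalikow.IsLookbackGenerator T μ h ∧
        Kalikow.Determines μ h P ∧
        (∃ f : Ω → ℕ, Measurable f ∧ Kalikow.entropy μ f < ENNReal.ofReal ε ∧
          Kalikow.Determines μ
            (fun ω (k : ℕ) => (P ((T ^ (k + 1)) ω), f ((T ^ (k + 1)) ω)))
            (fun ω (k : ℕ) => h ((T ^ (k + 1)) ω))) ∧
        (Kalikow.entropy μ P < ∞ →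
          Kalikow.processEntropy T μ P ≤
            Kalikow.condEntropy μ P (Kalikow.futureSigma T h) + ENNReal.ofReal ε)) ∧
    -- it can be chosen so that the property also holds for the inverse of `T`
    (∃ h : Ω → ℕ, Kalikow.IsLookbackGenerator T μ h ∧
      Kalikow.IsLookbackGenerator T⁻¹ μ h) := by
  have := hμ.isProbabilityMeasure
  have hc : ∃ h : Ω → ℕ, Kalikow.IsLookbackGenerator T μ h ∧
      Kalikow.IsLookbackGenerator T⁻¹ μ h := by
    obtain ⟨h, h1, h2, h3, h4, h5, h6⟩ := hμ.exists_two_sided_generator hT hper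
    obtain ⟨h', hm, hpos, he⟩ := Kalikow.exists_measurable_pos_ae_eq h1 h2
    have he' := hμ.ae_orbit hT he
    have he'' : ∀ᵐ ω ∂μ, ∀ k : ℤ, h ((T⁻¹ ^ k) ω) = h' ((T⁻¹ ^ k) ω) := by
      filter_upwards [he'] with ω hω k
      simpa using hω (-k)
    exact ⟨h', ⟨hm, hpos, h3.congr he', h5.congr he'⟩, ⟨hm, hpos, h4.congr he'', h6.congr he''⟩⟩
  -- The two-sided generator also serves for (a).
  refine ⟨hc.imp fun h hh => hh.1, fun P hP hgen ε hε => ?_, hc⟩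
  obtain ⟨h, f, h1, h1', h1g, h1d, h2, h3, h4, Y, hY, h5⟩ :=
    hμ.exists_one_sided_generator hT hper hP hgen (ENNReal.ofReal_pos.2 hε).ne'
  obtain ⟨h', hm, hpos, he⟩ := Kalikow.exists_measurable_pos_ae_eq h1 h1'
  obtain ⟨f', hfm, hfe⟩ := Kalikow.exists_measurable_ae_eq h3
  have hgood : ∀ᵐ ω ∂μ, ω ∉ Y ∧ h ω = h' ω ∧ f ω = f' ω :=
    (measure_eq_zero_iff_ae_notMem.1 hY).and (he.and hfe)
  have hgood' := hμ.ae_orbit hT hgood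
  set W : Set Ω := {ω | ¬∀ k : ℤ, (T ^ k) ω ∉ Y ∧ h ((T ^ k) ω) = h' ((T ^ k) ω) ∧
    f ((T ^ k) ω) = f' ((T ^ k) ω)} with hW
  have hfent : Kalikow.entropy μ f' = Kalikow.entropy μ f := by
    refine tsum_congr fun a => ?_
    congr 2
    refine measureReal_congr ?_
    filter_upwards [hfe] with ω hω
    exact congrArg (· = a) hω.symm
  -- The finite reading range `N`, which depends on `ω₁`, is kept: it makes the future of `h'`
  -- measurable, modulo null sets, with respect to the future of `(P, f')`.
  have hdet : ∀ k : ℕ, ∀ ω₁ ∉ W, ∃ N : ℕ, ∀ ω₂ ∉ W,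
      (∀ j < N, (P ((T ^ (j + 1)) ω₁), f' ((T ^ (j + 1)) ω₁)) =
        (P ((T ^ (j + 1)) ω₂), f' ((T ^ (j + 1)) ω₂))) →
      h' ((T ^ (k + 1)) ω₁) = h' ((T ^ (k + 1)) ω₂) := by
    intro k ω₁ hω₁
    have hW₁ : ∀ j : ℕ, _ := fun j => not_not.1 hω₁ (j : ℤ)
    simp only [zpow_natCast] at hW₁
    obtain ⟨N, hN⟩ := h5 _ (hW₁ (k + 1)).1
    refine ⟨k + N, fun ω₂ hω₂ hj => ?_⟩
    have hW₂ : ∀ j : ℕ, _ := fun j => not_not.1 hω₂ (j : ℤ)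
    simp only [zpow_natCast] at hW₂
    rw [← (hW₁ (k + 1)).2.1, ← (hW₂ (k + 1)).2.1]
    refine hN _ (hW₂ (k + 1)).1 fun i hi => ?_
    have h6 := hj (i + k) (by omega)
    rw [← Equiv.Perm.mul_apply, ← Equiv.Perm.mul_apply, ← pow_add, ← add_assoc,
      (hW₁ (i + k + 1)).2.2, (hW₂ (i + k + 1)).2.2]
    exact Prod.ext_iff.1 h6
  have he' : ∀ᵐ ω ∂μ, ∀ k : ℤ, h ((T ^ k) ω) = h' ((T ^ k) ω) :=
    hgood'.mono fun ω hω k => (hω k).2.1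
  refine ⟨h', ⟨hm, hpos, h1g.congr he', h1d.congr he'⟩, ?_,
    ⟨f', hfm, hfent ▸ h4, W, hgood', fun ω₁ hω₁ ω₂ hω₂ heq => funext fun k => ?_⟩, fun hfin => ?_⟩
  · obtain ⟨X, hX, H⟩ := h2
    refine ⟨X ∪ W, measure_union_null hX hgood', fun ω₁ hω₁ ω₂ hω₂ heq => ?_⟩
    rw [Set.mem_union, not_or] at hω₁ hω₂
    have e₁ := (not_not.1 hω₁.2 0).2.1
    have e₂ := (not_not.1 hω₂.2 0).2.1
    simp only [zpow_zero, Equiv.Perm.coe_one, id_eq] at e₁ e₂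
    exact H ω₁ hω₁.1 ω₂ hω₂.1 (by rw [e₁, e₂, heq])
  · obtain ⟨N, hN⟩ := hdet k ω₁ hω₁
    exact hN ω₂ hω₂ fun j _ => congrFun heq j
  · refine (Kalikow.processEntropy_le_condEntropy_add hT hP hfm hm hfin (iSup_le fun k => ?_)).trans
      (add_le_add_right (hfent ▸ h4).le _)
    refine Kalikow.comap_le_eventuallyMeasurableSpace
      (S := fun j ω => (P ((T ^ (j + 1)) ω), f' ((T ^ (j + 1)) ω))) (fun j => ?_) hgood' (hdet k)
    exact (comap_measurable _).mono (le_iSup (fun k : ℕ => MeasurableSpace.comap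
      (fun ω => (P ((T ^ (k + 1)) ω), f' ((T ^ (k + 1)) ω))) inferInstance) j) le_rfl
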